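/- Let $n\ge 3$, $R>0$, $B=\{x\in\mathbb R^n:|x|<R\}$, and let $f$ be an infinitely differentiable (real- or complex-valued) function on $\mathbb R^n$ with compact support contained in the open ball $B$. For $\xi\in\partial B$ and $t>0$ let $$(Mf)(\xi,t)=\frac1{\sigma_{n-1}}\int_{S^{n-1}}f(\xi-t\theta)\,d\theta$$ be the spherical means of $f$, where $d\theta$ is the surface measure on the unit sphere $S^{n-1}$ and $\sigma_{n-1}$ is its area. Let $d\xi$ be the surface measure on $\partial B$, let $D=\frac1{2t}\frac{d}{dt}$, and let $\Delta=\sum_{k=1}^n\partial^2/\partial x_k^2$. Then $(Mf)(\xi,\cdot)$ is infinitely differentiable on $(0,\infty)$ for every $\xi\in\partial B$, and the following holds. (i) If $n=3,5,\dots$, then for every $x\in B$ $$f(x)=d_{n,1}\,\Delta\int_{\partial B}D^{n-3}\big[t^{n-2}(Mf)(\xi,t)\big]\Big|_{t=|x-\xi|}\,d\xi,\qquad d_{n,1}=\frac{(-1)^{(n-1)/2}\,\pi^{1-n/2}}{4R\,\Gamma(n/2)}.$$ (ii) If $n=4,6,\dots$, then for every $x\in B$ $$f(x)=d_{n,2}\,\Delta\int_{\partial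 B}d\xi\int_0^{2R}t\,D^{n-2}\big[t^{n-2}(Mf)(\xi,t)\big]\log\big|t^2-|x-\xi|^2\big|\,dt,\qquad d_{n,2}=\frac{(-1)^{n/2-1}\,\pi^{-n/2}}{2R\,(n/2-1)!}.$$ Here, for every $x\in B$, the integrals converge absolutely (in (ii), both the inner integral for each $\xi\in\partial B$ and the outer integral), and the functions of $x$ to which $\Delta$ is applied are twice continuously differentiable in $B$. -/

import Mathlib

open Set MeasureTheory Metric
open scoped ContDiff Nat

namespace SphericalMeans

/-- Euclidean space `ℝⁿ`. -/
abbrev E (n : ℕ) : Type := EuclideanSpace ℝ (Fin n)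

/-- The usual surface measure on the unit sphere `S^{n-1}` of `ℝⁿ` (`σ(A) = n · vol((0,1)·A)`);
its total mass is the area `σ_{n-1}`. -/
noncomputable def unitSphereMeasure (n : ℕ) : Measure (sphere (0 : E n) 1) :=
  (volume : Measure (E n)).toSphere

/-- The surface measure `dξ` on the sphere `∂B = {|ξ| = R}`, as a measure on `ℝⁿ`: the image of
the surface measure of the unit sphere under `θ ↦ R θ`, multiplied by `R^{n-1}`. -/
noncomputable def sphereMeasure (n : ℕ) (R : ℝ) : Measure (E n) :=
  ENNReal.ofReal (R ^ (n - 1)) •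
    (unitSphereMeasure n).map (fun θ : sphere (0 : E n) 1 => R • (θ : E n))

variable {𝕜 : Type*} [RCLike 𝕜] {n : ℕ}

/-- The spherical mean `(Mf)(ξ, t) = (1/σ_{n-1}) ∫_{S^{n-1}} f(ξ - tθ) dθ`. -/
noncomputable def sphericalMean (f : E n → 𝕜) (ξ : E n) (t : ℝ) : 𝕜 :=
  ((unitSphereMeasure n).real univ)⁻¹ •
    ∫ θ : sphere (0 : E n) 1, f (ξ - t • (θ : E n)) ∂(unitSphereMeasure n)

/-- The operator `D = (1/2t) d/dt`. -/
noncomputable def opD (g : ℝ → 𝕜) : ℝ → 𝕜 := fun t => (1 / (2 * t)) • deriv g t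

/-- `D^k [t^{n-2} (Mf)(ξ, t)]` as a function of `ξ` and `t`. -/
noncomputable def filteredMean (k : ℕ) (f : E n → 𝕜) (ξ : E n) : ℝ → 𝕜 :=
  opD^[k] (fun t => t ^ (n - 2) • sphericalMean f ξ t)

/-- `∫_{∂B} D^{n-3}[t^{n-2} (Mf)(ξ, t)]|_{t = |x - ξ|} dξ`. -/
noncomputable def oddIntegral (R : ℝ) (f : E n → 𝕜) (x : E n) : 𝕜 :=
  ∫ ξ, filteredMean (n - 3) f ξ ‖x - ξ‖ ∂(sphereMeasure n R)

/-- The inner integrand `t D^{n-2}[t^{n-2} (Mf)(ξ, t)] log |t² - |x - ξ|²|`. -/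
noncomputable def evenIntegrand (f : E n → 𝕜) (x ξ : E n) (t : ℝ) : 𝕜 :=
  (t * Real.log |t ^ 2 - ‖x - ξ‖ ^ 2|) • filteredMean (n - 2) f ξ t

/-- `∫_{∂B} dξ ∫_0^{2R} t D^{n-2}[t^{n-2} (Mf)(ξ, t)] log |t² - |x - ξ|²| dt`. -/
noncomputable def evenIntegral (R : ℝ) (f : E n → 𝕜) (x : E n) : 𝕜 :=
  ∫ ξ, (∫ t in (0 : ℝ)..(2 * R), evenIntegrand f x ξ t) ∂(sphereMeasure n R)

/-- `d_{n,1} = (-1)^{(n-1)/2} π^{1-n/2} / (4 R Γ(n/2))`, for odd `n`. -/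
noncomputable def dOdd (n : ℕ) (R : ℝ) : ℝ :=
  (-1) ^ ((n - 1) / 2) * Real.pi ^ (1 - (n : ℝ) / 2) / (4 * R * Real.Gamma ((n : ℝ) / 2))

/-- `d_{n,2} = (-1)^{n/2-1} π^{-n/2} / (2 R (n/2-1)!)`, for even `n`. -/
noncomputable def dEven (n : ℕ) (R : ℝ) : ℝ :=
  (-1) ^ (n / 2 - 1) * Real.pi ^ (-((n : ℝ) / 2)) / (2 * R * ((n / 2 - 1)! : ℝ))

end SphericalMeans

/-! Write n = p + 3 and r = |x - ξ|, and let T be the real part (n even) or the imaginary part (n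
odd) on ℂ. Both formulas come from the single kernel T log(t² - r²): its real part is log|t² - r²|,
and its imaginary part is π for t < r and 0 otherwise, so that in the odd case one integration turns
the moment of D^{n-2}[t^{n-2}Mf] into (π/2) D^{n-3}[t^{n-2}Mf] at t = r.

Regularize to log(t² - r² + iε). In the variable u = t² the operator D is d/du, and the data vanish
near t = 0 and t = 2R because f is supported at positive distance from the sphere. Integrating by
parts n-2 times leaves (t² - r² + iε)^{-(n-2)} against t^{n-2}Mf, and polar coordinates about ξ make
this an integral of (|y-ξ|² - |x-ξ|² + iε)^{-(n-2)} f(y) over y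
(`integral_log_kernel_filteredMean`).

Now integrate over ξ = Rθ. The difference |y-ξ|² - |x-ξ|² is affine in ξ, equal to 2R|x-y|(h -
⟨e,θ⟩) with e a unit vector and h = (|y|² - |x|²)/(2R|x-y|). The sphere integral is therefore
|x-y|^{2-n} times a multiple of ∫ sin^{n-2}φ (z - cos φ)^{-(n-2)} dφ with z = h + iε'
(`integral_sphere_invKernel`). The z-derivative of this integral is a constant times (1 -
z²)^{-(n-1)/2} (`cauchySin_eq`). Its boundary values on (-1,1) lie in (-i)^{n-1}ℝ, which T kills.
Since |h| < 1 for x and y in the ball, the limit of T of the integral does not depend on h and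
equals its value π T((-i)^{n-2}) at h = 0 (`tendsto_cauchySin`).

Hence backprojection gives a constant multiple of the Newtonian potential of f
(`integral_log_filteredMean`). This is smooth, and its Laplacian is a multiple of f
(`laplacian_newtonPotential`); the constants match by the duplication formula for Γ. Dominated
convergence justifies both limits ε → 0: logarithmic singularities are integrable in t, uniformly in
r, and |x-y|^{2-n} is locally integrable in y. -/

open Filter Topology

namespace SphericalMeans

/-! ### Polar coordinates and the surface measure -/

section Polar

variable {n : ℕ} {F : Type*} [NormedAddCommGroup F] [NormedSpace ℝ F]

/-- Integration in polar coordinates. -/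
theorem integral_polar (hn : n ≠ 0) {g : E n → F} (hg : Integrable g) :
    ∫ w, g w = ∫ r in Ioi (0 : ℝ), r ^ (n - 1) •
      ∫ θ : sphere (0 : E n) 1, g (r • (θ : E n)) ∂(unitSphereMeasure n) := by
  have : Nontrivial (E n) := by
    have : Nonempty (Fin n) := ⟨⟨0, Nat.pos_of_ne_zero hn⟩⟩
    infer_instance
  have hmp := (volume : Measure (E n)).measurePreserving_homeomorphUnitSphereProd
  have hemb := (homeomorphUnitSphereProd (E n)).measurableEmbedding
  set G : sphere (0 : E n) 1 × Ioi (0 : ℝ) → F := fun p => g ((p.2 : ℝ) • (p.1 : E n)) with hG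
  have hcomp : ∀ x : ({0}ᶜ : Set (E n)), G (homeomorphUnitSphereProd (E n) x) = g x := by
    intro x
    have hx : ‖(x : E n)‖ ≠ 0 := norm_ne_zero_iff.2 x.2
    simp [hG, smul_smul, hx]
  have hint : Integrable G ((unitSphereMeasure n).prod (Measure.volumeIoiPow (n - 1))) := by
    have h1 : Integrable (G ∘ homeomorphUnitSphereProd (E n))
        ((volume : Measure (E n)).comap (Subtype.val : ({0}ᶜ : Set (E n)) → E n)) := by
      rw [show G ∘ homeomorphUnitSphereProd (E n) = g ∘ Subtype.val from funext hcomp]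
      exact (integrableOn_iff_comap_subtypeVal (by measurability)).1 hg.integrableOn
    have := (hmp.integrable_comp_emb hemb).1 h1
    simpa [unitSphereMeasure] using this
  calc ∫ w, g w = ∫ x : ({0}ᶜ : Set (E n)), g x
        ∂((volume : Measure (E n)).comap (Subtype.val : ({0}ᶜ : Set (E n)) → E n)) := by
        rw [integral_subtype_comap (measurableSet_singleton _).compl g,
          restrict_compl_singleton]
    _ = ∫ p, G p ∂((unitSphereMeasure n).prod (Measure.volumeIoiPow (n - 1))) := by
        have := hmp.integral_comp hemb G
        simp_rw [hcomp] at this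
        rw [this]
        simp [unitSphereMeasure]
    _ = ∫ r : Ioi (0 : ℝ), (∫ θ : sphere (0 : E n) 1, g ((r : ℝ) • (θ : E n))
          ∂(unitSphereMeasure n)) ∂(Measure.volumeIoiPow (n - 1)) := by
        have : IsFiniteMeasure (unitSphereMeasure n) := by
          unfold unitSphereMeasure; infer_instance
        rw [integral_prod_symm _ hint]
    _ = _ := by
        simp only [Measure.volumeIoiPow, ENNReal.ofReal]
        rw [integral_withDensity_eq_integral_smul,
          integral_subtype_comap measurableSet_Ioi fun a : ℝ ↦ Real.toNNReal (a ^ (n - 1)) •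
            ∫ θ : sphere (0 : E n) 1, g (a • (θ : E n)) ∂(unitSphereMeasure n)]
        · refine setIntegral_congr_fun measurableSet_Ioi fun x hx ↦ ?_
          simp only [NNReal.smul_def, Real.coe_toNNReal _ (pow_nonneg hx.out.le _)]
        · exact (measurable_subtype_coe.pow_const _).real_toNNReal

instance : IsFiniteMeasure (unitSphereMeasure n) := by
  unfold unitSphereMeasure; infer_instance

instance (R : ℝ) : IsFiniteMeasure (sphereMeasure n R) := by
  unfold sphereMeasure
  exact Measure.smul_finite _ ENNReal.ofReal_ne_top

theorem integral_sphereMeasure {R : ℝ} (hR : 0 ≤ R) {g : E n → F} (hg : StronglyMeasurable g) :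
    ∫ ξ, g ξ ∂(sphereMeasure n R) =
      R ^ (n - 1) • ∫ θ : sphere (0 : E n) 1, g (R • (θ : E n)) ∂(unitSphereMeasure n) := by
  rw [sphereMeasure, integral_smul_measure, integral_map (by fun_prop) hg.aestronglyMeasurable,
    ENNReal.toReal_ofReal (by positivity)]

theorem ae_mem_sphere {R : ℝ} (hR : 0 ≤ R) :
    ∀ᵐ ξ ∂(sphereMeasure n R), ξ ∈ sphere (0 : E n) R := by
  refine Measure.ae_smul_measure ?_ _
  refine (ae_map_iff (p := fun x => x ∈ sphere (0 : E n) R) (by fun_prop)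
    isClosed_sphere.measurableSet).2 ?_
  refine ae_of_all _ fun θ => ?_
  simp [norm_smul, abs_of_nonneg hR]

theorem unitSphereMeasure_real_pos (hn : n ≠ 0) : 0 < (unitSphereMeasure n).real univ := by
  have : Nontrivial (E n) := by
    have : Nonempty (Fin n) := ⟨⟨0, Nat.pos_of_ne_zero hn⟩⟩
    infer_instance
  have : NeZero (unitSphereMeasure n) := ⟨Measure.toSphere_ne_zero _⟩
  exact measureReal_univ_pos

end Polar

/-! ### Smooth dependence of integrals on parameters -/

section Parametric

variable {V W K : Type} [NormedAddCommGroup V] [NormedSpace ℝ V] [FiniteDimensional ℝ V]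
  [NormedAddCommGroup W] [NormedSpace ℝ W]
  [TopologicalSpace K] [CompactSpace K] [MeasurableSpace K] [BorelSpace K]
  [SecondCountableTopology K]

/-- Parametric integrals of smooth functions over compact spaces are smooth. -/
theorem contDiff_integral_compact (μ : Measure K) [IsFiniteMeasure μ] {i : K → W}
    (hi : Continuous i) {F : Type*} [NormedAddCommGroup F] [NormedSpace ℝ F]
    {G : V × W → F} (hG : ContDiff ℝ ∞ G) :
    ContDiff ℝ ∞ (fun v => ∫ k, G (v, i k) ∂μ) := by
  rw [contDiff_infty]
  intro m
  have hmeas : ∀ {F : Type _} [NormedAddCommGroup F] {H : V × W → F}, Continuous H → ∀ v : V,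
      Integrable (fun k => H (v, i k)) μ := by
    intro F _ H hH v
    have hc : Continuous fun k => H (v, i k) := by fun_prop
    obtain ⟨C, hC⟩ := (isCompact_range hc).isBounded.exists_norm_le
    exact Integrable.of_bound hc.aestronglyMeasurable C
      (ae_of_all _ fun k => hC _ (mem_range_self k))
  -- The derivative takes values in continuous linear maps from V to F, so the codomain must be free
  -- in the induction.
  induction m generalizing F with
  | zero =>
    have := continuous_parametric_integral_of_continuous (μ := μ) (s := univ)
      (f := fun v k => G (v, i k)) (by have := hG.continuous; fun_prop) isCompact_univ
    simpa using this
  | succ m ih =>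
    have hfd : ContDiff ℝ ∞ fun p : V × W => (fderiv ℝ G p).comp (ContinuousLinearMap.inl ℝ V W) :=
      ((hG.fderiv_right (m := ∞) (by simp)).clm_comp contDiff_const)
    have hder : ∀ v, HasFDerivAt (fun v => ∫ k, G (v, i k) ∂μ)
        (∫ k, (fderiv ℝ G (v, i k)).comp (ContinuousLinearMap.inl ℝ V W) ∂μ) v := by
      intro v
      have hcpt : IsCompact (closedBall v 1 ×ˢ range i) :=
        (isCompact_closedBall v 1).prod (isCompact_range hi)
      obtain ⟨C, hC⟩ := (hcpt.image hfd.continuous).isBounded.exists_norm_le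
      refine (hasFDerivAt_integral_of_dominated_of_fderiv_le (bound := fun _ => C)
        (F' := fun v k => (fderiv ℝ G (v, i k)).comp (ContinuousLinearMap.inl ℝ V W))
        (closedBall_mem_nhds v one_pos) ?_ ?_ ?_ ?_ ?_ ?_)
      · exact Eventually.of_forall fun w => (hmeas hG.continuous w).aestronglyMeasurable
      · exact hmeas hG.continuous v
      · exact (hmeas hfd.continuous v).aestronglyMeasurable
      · exact ae_of_all _ fun k w hw => hC _ ⟨(w, i k), ⟨hw, mem_range_self k⟩, rfl⟩
      · exact integrable_const _
      · refine ae_of_all _ fun k w hw => ?_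
        have h1 := (hG.differentiable (by simp) (w, i k)).hasFDerivAt
        exact h1.comp w ((hasFDerivAt_id w).prodMk (hasFDerivAt_const (i k) w))
    rw [show ((m + 1 : ℕ) : WithTop ℕ∞) = (m : WithTop ℕ∞) + 1 by norm_cast, contDiff_succ_iff_fderiv]
    refine ⟨fun v => (hder v).differentiableAt, by simp, ?_⟩
    rw [show fderiv ℝ (fun v => ∫ k, G (v, i k) ∂μ) = _ from funext fun v => (hder v).fderiv]
    exact ih hfd

end Parametric

end SphericalMeans

namespace SphericalMeans

variable {𝕜 : Type*} [RCLike 𝕜] {n : ℕ}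

/-! ### Smoothness of the spherical means and of their filtered versions -/

section Smoothness

theorem contDiff_sphericalMean {f : E n → 𝕜} (hf : ContDiff ℝ ∞ f) :
    ContDiff ℝ ∞ fun p : E n × ℝ => sphericalMean f p.1 p.2 := by
  unfold sphericalMean
  refine ContDiff.const_smul _ ?_
  exact contDiff_integral_compact (unitSphereMeasure n) (K := sphere (0 : E n) 1)
    (i := fun θ => (θ : E n)) continuous_subtype_val
    (G := fun q : (E n × ℝ) × E n => f (q.1.1 - q.1.2 • q.2)) (by fun_prop)

/-- Smoothness is needed jointly in the centre and the radius, since the later bounds uniform in ξ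
come from compactness. The t-derivative inside D is therefore read as the full derivative in the
direction (0, 1). -/
theorem contDiffOn_filteredMean {f : E n → 𝕜} (hf : ContDiff ℝ ∞ f) (k : ℕ) :
    ContDiffOn ℝ ∞ (fun p : E n × ℝ => filteredMean k f p.1 p.2) (univ ×ˢ Ioi 0) := by
  have hopen : IsOpen ((univ : Set (E n)) ×ˢ Ioi (0 : ℝ)) := isOpen_univ.prod isOpen_Ioi
  induction k with
  | zero =>
    simp only [filteredMean, Function.iterate_zero, id]
    exact ((contDiff_snd.pow _).smul (contDiff_sphericalMean hf)).contDiffOn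
  | succ k ih =>
    have h1 : ContDiffOn ℝ ∞ (fun p : E n × ℝ => (1 / (2 * p.2)) •
        fderiv ℝ (fun p : E n × ℝ => filteredMean k f p.1 p.2) p (0, 1)) (univ ×ˢ Ioi 0) := by
      have hd := (ih.fderiv_of_isOpen (m := ∞) hopen (by simp)).clm_apply
        (contDiffOn_const (c := ((0, 1) : E n × ℝ)))
      have h0 : ContDiffOn ℝ ∞ (fun p : E n × ℝ => 1 / (2 * p.2)) (univ ×ˢ Ioi 0) := by
        refine contDiffOn_const.div (by fun_prop) fun p hp => ?_
        have : 0 < p.2 := hp.2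
        positivity
      exact h0.smul hd
    refine h1.congr fun p hp => ?_
    simp only [filteredMean, Function.iterate_succ_apply', opD]
    congr 1
    have hd : DifferentiableAt ℝ (fun p : E n × ℝ => filteredMean k f p.1 p.2) (p.1, p.2) :=
      (ih.contDiffAt (hopen.mem_nhds hp)).differentiableAt (by simp)
    have := (hd.hasFDerivAt.comp_hasDerivAt p.2
      ((hasDerivAt_const p.2 p.1).prodMk (hasDerivAt_id p.2))).deriv
    exact this

end Smoothness

/-! ### Integration by parts for D, and spherical means as volume integrals -/

section Bump

/-- A function on the half line, smooth for `t > 0`, that vanishes for `|t| < δ` and for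
`t > b - δ`. -/
structure IsBump (δ b : ℝ) (G : ℝ → 𝕜) : Prop where
  contDiffOn : ContDiffOn ℝ ∞ G (Ioi 0)
  eq_zero_left : ∀ t, |t| < δ → G t = 0
  eq_zero_right : ∀ t, b - δ < t → G t = 0

variable {δ b : ℝ} {G : ℝ → 𝕜}

theorem IsBump.eventuallyEq_left (hG : IsBump δ b G) {t : ℝ} (ht : |t| < δ) :
    G =ᶠ[𝓝 t] fun _ => 0 := by
  filter_upwards [(isOpen_lt continuous_abs continuous_const).mem_nhds ht] with s hs
  exact hG.eq_zero_left s hs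

theorem IsBump.eventuallyEq_right (hG : IsBump δ b G) {t : ℝ} (ht : b - δ < t) :
    G =ᶠ[𝓝 t] fun _ => 0 := by
  filter_upwards [isOpen_Ioi.mem_nhds ht] with s hs
  exact hG.eq_zero_right s hs

theorem IsBump.contDiffAt (hG : IsBump δ b G) {t : ℝ} (hδ : 0 < δ) (ht : 0 ≤ t) :
    ContDiffAt ℝ ∞ G t := by
  rcases ht.eq_or_lt with rfl | ht
  · exact contDiffAt_const.congr_of_eventuallyEq (hG.eventuallyEq_left (by simpa using hδ))
  · exact hG.contDiffOn.contDiffAt (isOpen_Ioi.mem_nhds ht)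

theorem IsBump.opD (hG : IsBump δ b G) : IsBump δ b (opD G) where
  contDiffOn := by
    unfold SphericalMeans.opD
    refine ContDiffOn.smul (contDiffOn_const.div (contDiffOn_const.mul contDiffOn_id)
      fun t ht => ?_) (hG.contDiffOn.deriv_of_isOpen (m := ∞) isOpen_Ioi (by simp))
    have : 0 < t := ht
    positivity
  eq_zero_left t ht := by
    simp [SphericalMeans.opD, (hG.eventuallyEq_left ht).deriv_eq]
  eq_zero_right t ht := by
    simp [SphericalMeans.opD, (hG.eventuallyEq_right ht).deriv_eq]

/-- In the variable u = t² one has D = d/du and t dt = du/2, so this is ordinary integration by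
parts against η(u). The boundary terms drop out because G vanishes at both ends. -/
theorem IsBump.integral_opD (hG : IsBump δ b G) (hδ : 0 < δ) (hb : 0 ≤ b) {η η' : ℝ → ℝ}
    (hη : ∀ u, HasDerivAt η (η' u) u) (hη' : Continuous η') :
    ∫ t in (0 : ℝ)..b, (t * η (t ^ 2)) • SphericalMeans.opD G t =
      -∫ t in (0 : ℝ)..b, (t * η' (t ^ 2)) • G t := by
  have hηc : Continuous η := continuous_iff_continuousAt.2 fun u => (hη u).continuousAt
  have hsub : ∀ t ∈ uIcc 0 b, 0 ≤ t := fun t ht => by rw [uIcc_of_le hb] at ht; exact ht.1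
  have hGc : ContinuousOn G (uIcc 0 b) := fun t ht =>
    (hG.contDiffAt hδ (hsub t ht)).continuousAt.continuousWithinAt
  have hdG : ContinuousOn (deriv G) (uIcc 0 b) := fun t ht =>
    (((hG.contDiffAt hδ (hsub t ht)).continuousAt_fderiv (by simp)).clm_apply
      continuousAt_const).continuousWithinAt
  have hder : ∀ t ∈ uIcc 0 b, HasDerivAt (fun t => η (t ^ 2) • G t)
      (η (t ^ 2) • deriv G t + (η' (t ^ 2) * (2 * t)) • G t) t := by
    intro t ht
    have h1 : HasDerivAt (fun t : ℝ => η (t ^ 2)) (η' (t ^ 2) * (2 * t)) t := by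
      have := (hη (t ^ 2)).comp t (hasDerivAt_pow 2 t)
      simpa [Function.comp_def] using this
    exact h1.smul ((hG.contDiffAt hδ (hsub t ht)).differentiableAt (by simp)).hasDerivAt
  have hi1 : IntervalIntegrable (fun t => η (t ^ 2) • deriv G t) volume 0 b :=
    ContinuousOn.intervalIntegrable (by fun_prop)
  have hi2 : IntervalIntegrable (fun t => (η' (t ^ 2) * (2 * t)) • G t) volume 0 b :=
    ContinuousOn.intervalIntegrable (by fun_prop)
  have hftc := intervalIntegral.integral_eq_sub_of_hasDerivAt hder (hi1.add hi2)
  rw [intervalIntegral.integral_add hi1 hi2, hG.eq_zero_right b (by linarith),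
    hG.eq_zero_left 0 (by simpa using hδ)] at hftc
  have e1 : ∫ t in (0 : ℝ)..b, (t * η (t ^ 2)) • SphericalMeans.opD G t =
      (1 / 2 : ℝ) • ∫ t in (0 : ℝ)..b, η (t ^ 2) • deriv G t := by
    rw [← intervalIntegral.integral_smul]
    refine intervalIntegral.integral_congr fun t ht => ?_
    simp only [SphericalMeans.opD, smul_smul]
    -- At t = 0 the product t · (1/(2t)) is 0 instead of 1/2, which is harmless since G is constant
    -- near 0.
    rcases (hsub t ht).eq_or_lt with rfl | h0
    · simp [(hG.eventuallyEq_left (t := 0) (by simpa using hδ)).deriv_eq]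
    · congr 1; field_simp
  have e2 : ∫ t in (0 : ℝ)..b, (t * η' (t ^ 2)) • G t =
      (1 / 2 : ℝ) • ∫ t in (0 : ℝ)..b, (η' (t ^ 2) * (2 * t)) • G t := by
    rw [← intervalIntegral.integral_smul]
    refine intervalIntegral.integral_congr fun t ht => ?_
    simp only [smul_smul]
    congr 1; ring
  rw [e1, e2, ← smul_neg]
  congr 1
  rw [smul_zero, smul_zero, sub_zero] at hftc
  exact eq_neg_of_add_eq_zero_left hftc

variable {f : E n → 𝕜} {R ρ : ℝ}

/-- A sphere centred at distance R from the origin misses the closed ball of radius ρ if its radius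
is below R - ρ or above R + ρ = 2R - (R - ρ). Applying D preserves the vanishing. -/
theorem isBump_filteredMean (hf : ContDiff ℝ ∞ f) (hs : ∀ y, ρ < ‖y‖ → f y = 0)
    {ξ : E n} (hξ : ξ ∈ sphere (0 : E n) R) (k : ℕ) :
    IsBump (R - ρ) (2 * R) (filteredMean k f ξ) := by
  have hξ' : ‖ξ‖ = R := by simpa using hξ
  induction k with
  | zero =>
    have key : ∀ t, (∀ θ : sphere (0 : E n) 1, ρ < ‖ξ - t • (θ : E n)‖) →
        filteredMean 0 f ξ t = 0 := by
      intro t ht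
      simp [filteredMean, sphericalMean, hs _ (ht _)]
    have hn : ∀ (t : ℝ) (θ : sphere (0 : E n) 1), ‖t • (θ : E n)‖ = |t| := fun t θ => by
      simp [norm_smul]
    refine ⟨?_, fun t ht => key t fun θ => ?_, fun t ht => key t fun θ => ?_⟩
    · simp only [filteredMean, Function.iterate_zero, id]
      have := (contDiff_sphericalMean hf).comp (contDiff_const.prodMk contDiff_id : ContDiff ℝ ∞
        fun t : ℝ => (ξ, t))
      exact ((contDiff_id.pow _).smul this).contDiffOn
    · have := norm_sub_norm_le ξ (t • (θ : E n))
      rw [hn, hξ'] at this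
      linarith
    · have := norm_sub_norm_le (t • (θ : E n)) ξ
      rw [hn, hξ', norm_sub_rev] at this
      linarith [le_abs_self t]
  | succ k ih =>
    rw [filteredMean, Function.iterate_succ_apply']
    exact ih.opD

/-- Polar coordinates around a point of the sphere, in terms of spherical means. -/
theorem integral_filteredMean_zero (hn : 2 ≤ n) (hf : ContDiff ℝ ∞ f) (hfc : HasCompactSupport f)
    (hR : 0 ≤ R) (hρR : ρ < R) (hs : ∀ y, ρ < ‖y‖ → f y = 0) {ξ : E n}
    (hξ : ξ ∈ sphere (0 : E n) R) {η : ℝ → ℝ} (hη : Continuous η) :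
    ∫ t in (0 : ℝ)..(2 * R), (t * η (t ^ 2)) • filteredMean 0 f ξ t =
      ((unitSphereMeasure n).real univ)⁻¹ • ∫ y, η (‖y - ξ‖ ^ 2) • f y := by
  have hfcont := hf.continuous
  have e1 : ∫ y, η (‖y - ξ‖ ^ 2) • f y = ∫ w, η (‖w‖ ^ 2) • f (ξ - w) := by
    rw [← integral_sub_left_eq_self (fun y => η (‖y - ξ‖ ^ 2) • f y) volume ξ]
    refine integral_congr_ae (ae_of_all _ fun w => ?_)
    simp only [sub_sub_cancel_left, norm_neg]
  have hint : Integrable fun w => η (‖w‖ ^ 2) • f (ξ - w) := by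
    have h1 : Continuous fun w : E n => η (‖w‖ ^ 2) := hη.comp (continuous_norm.pow 2)
    have h2 : Continuous fun w : E n => f (ξ - w) := hfcont.comp (continuous_const.sub continuous_id)
    have h3 : HasCompactSupport fun w => f (ξ - w) := hfc.comp_homeomorph (Homeomorph.subLeft ξ)
    exact (h1.smul h2).integrable_of_hasCompactSupport h3.smul_left
  have hσ := unitSphereMeasure_real_pos (n := n) (by omega)
  rw [e1, integral_polar (by omega) hint, ← integral_smul,
    intervalIntegral.integral_of_le (by linarith)]
  have hzero : ∀ t ∈ Ioi (0 : ℝ) \ Ioc 0 (2 * R),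
      (t * η (t ^ 2)) • filteredMean 0 f ξ t = 0 := by
    intro t ht
    have : 2 * R < t := by
      by_contra h
      exact ht.2 ⟨ht.1, not_lt.1 h⟩
    rw [(isBump_filteredMean hf hs hξ 0).eq_zero_right t (by linarith), smul_zero]
  rw [← setIntegral_eq_of_subset_of_forall_sdiff_eq_zero measurableSet_Ioi
    (fun t (ht : t ∈ Ioc 0 (2 * R)) => ht.1) hzero]
  refine setIntegral_congr_fun measurableSet_Ioi fun t (ht : 0 < t) => ?_
  have e2 : ∀ θ : sphere (0 : E n) 1, ‖t • (θ : E n)‖ = t := fun θ => by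
    simp [norm_smul, abs_of_pos ht]
  simp only [e2, filteredMean, Function.iterate_zero, id, sphericalMean]
  rw [integral_smul]
  simp only [smul_smul]
  congr 1
  -- The weight t · t^{n-2} is exactly the polar Jacobian t^{n-1}.
  obtain ⟨m, rfl⟩ := Nat.exists_eq_add_of_le hn
  rw [show 2 + m - 2 = m by omega, show 2 + m - 1 = m + 1 by omega]
  ring

end Bump

end SphericalMeans

namespace SphericalMeans

/-! ### The Stieltjes transform of the zonal weight in the upper half plane -/

section Stieltjes

/-- `∫_0^π sin^a φ (z - cos φ)^{-k} dφ`. -/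
noncomputable def cauchySin (a k : ℕ) (z : ℂ) : ℂ :=
  ∫ t in (0 : ℝ)..Real.pi, (Real.sin t : ℂ) ^ a * (z - Real.cos t)⁻¹ ^ k

theorem sub_ofReal_ne_zero {z : ℂ} (hz : 0 < z.im) (s : ℝ) : z - s ≠ 0 := by
  intro h
  have := congrArg Complex.im h
  simp at this
  linarith

theorem norm_inv_sub_ofReal_le {z : ℂ} (hz : 0 < z.im) (s : ℝ) : ‖(z - s)⁻¹‖ ≤ z.im⁻¹ := by
  rw [norm_inv]
  refine inv_anti₀ hz ?_
  have := Complex.abs_im_le_norm (z - s)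
  simp only [Complex.sub_im, Complex.ofReal_im, sub_zero] at this
  exact (le_abs_self _).trans this

theorem continuous_cauchySin_integrand (a k : ℕ) {z : ℂ} (hz : 0 < z.im) :
    Continuous fun t : ℝ => (Real.sin t : ℂ) ^ a * (z - Real.cos t)⁻¹ ^ k := by
  refine Continuous.mul (by fun_prop) ((Continuous.inv₀ (by fun_prop) fun t => ?_).pow k)
  exact sub_ofReal_ne_zero hz _

/-- Differentiation under the integral: on the disc of radius Im z / 2 the imaginary part stays
above Im z / 2, which bounds the differentiated integrand uniformly. -/
theorem hasDerivAt_cauchySin (a k : ℕ) {z : ℂ} (hz : 0 < z.im) :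
    HasDerivAt (cauchySin a k) (-k * cauchySin a (k + 1) z) z := by
  have him : ∀ w ∈ ball z (z.im / 2), z.im / 2 < w.im := by
    intro w hw
    have h1 := Complex.abs_im_le_norm (w - z)
    rw [mem_ball, dist_eq_norm] at hw
    have := (abs_lt.1 (h1.trans_lt hw)).1
    simp at this
    linarith
  have key := intervalIntegral.hasDerivAt_integral_of_dominated_loc_of_deriv_le
    (𝕜 := ℂ) (μ := volume) (a := 0) (b := Real.pi) (x₀ := z) (s := ball z (z.im / 2))
    (F := fun (w : ℂ) (t : ℝ) => (Real.sin t : ℂ) ^ a * (w - Real.cos t)⁻¹ ^ k)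
    (F' := fun (w : ℂ) (t : ℝ) => -(k : ℂ) * ((Real.sin t : ℂ) ^ a * (w - Real.cos t)⁻¹ ^ (k + 1)))
    (bound := fun _ => (k : ℝ) * ((z.im / 2)⁻¹) ^ (k + 1)) (ball_mem_nhds _ (by positivity))
    ?_ ?_ ?_ ?_ ?_ ?_
  · rw [intervalIntegral.integral_const_mul] at key
    exact key.2
  · filter_upwards [ball_mem_nhds z (show 0 < z.im / 2 by positivity)] with w hw
    exact (continuous_cauchySin_integrand a k ((half_pos hz).trans (him w hw))).aestronglyMeasurable
  · exact (continuous_cauchySin_integrand a k hz).intervalIntegrable _ _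
  · exact ((continuous_cauchySin_integrand a (k + 1) hz).const_mul _).aestronglyMeasurable
  · refine ae_of_all _ fun t _ w hw => ?_
    have hw' := him w hw
    have hwp : 0 < w.im := (half_pos hz).trans hw'
    rw [norm_mul, norm_neg, Complex.norm_natCast, norm_mul, norm_pow, norm_pow]
    have h1 : ‖((Real.sin t : ℝ) : ℂ)‖ ^ a ≤ 1 := by
      rw [Complex.norm_real]
      exact pow_le_one₀ (norm_nonneg _) (Real.abs_sin_le_one t)
    have h2 : ‖(w - (Real.cos t : ℝ))⁻¹‖ ^ (k + 1) ≤ ((z.im / 2)⁻¹) ^ (k + 1) := by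
      gcongr
      exact (norm_inv_sub_ofReal_le hwp _).trans (inv_anti₀ (half_pos hz) hw'.le)
    gcongr
    calc _ ≤ 1 * ((z.im / 2)⁻¹) ^ (k + 1) := by gcongr
      _ = _ := one_mul _
  · exact intervalIntegrable_const
  · refine ae_of_all _ fun t _ w hw => ?_
    have hwp : 0 < w.im := (half_pos hz).trans (him w hw)
    have hne := sub_ofReal_ne_zero hwp (Real.cos t)
    have h1 : HasDerivAt (fun w : ℂ => (w - (Real.cos t : ℝ))⁻¹) (-1 / (w - (Real.cos t : ℝ)) ^ 2) w :=
      ((hasDerivAt_id w).sub_const _).inv hne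
    have h2 := (h1.pow k).const_mul ((Real.sin t : ℂ) ^ a)
    refine h2.congr_deriv ?_
    rcases k with _ | k
    · simp
    · simp only [Nat.add_sub_cancel]
      push_cast only [Nat.cast_add, Nat.cast_one]
      simp only [div_eq_mul_inv, ← inv_pow]
      ring

/-- The function sin^{p+2} t (z - cos t)^{-(p+2)} vanishes at 0 and π. Its derivative is (p+2)
sin^{p+1} t (z - cos t)^{-(p+3)} (z cos t - 1), and z cos t - 1 = (z² - 1) - z(z - cos t). -/
theorem cauchySin_recurrence (p : ℕ) {z : ℂ} (hz : 0 < z.im) :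
    (z ^ 2 - 1) * cauchySin (p + 1) (p + 3) z = z * cauchySin (p + 1) (p + 2) z := by
  have hder : ∀ t ∈ uIcc 0 Real.pi, HasDerivAt
      (fun t : ℝ => (Real.sin t : ℂ) ^ (p + 2) * (z - Real.cos t)⁻¹ ^ (p + 2))
      ((p + 2) * ((z ^ 2 - 1) * ((Real.sin t : ℂ) ^ (p + 1) * (z - Real.cos t)⁻¹ ^ (p + 3))
        - z * ((Real.sin t : ℂ) ^ (p + 1) * (z - Real.cos t)⁻¹ ^ (p + 2)))) t := by
    intro t _
    have hne := sub_ofReal_ne_zero hz (Real.cos t)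
    have hs : HasDerivAt (fun t : ℝ => (Real.sin t : ℂ)) (Real.cos t) t :=
      (Real.hasDerivAt_sin t).ofReal_comp
    have hc : HasDerivAt (fun t : ℝ => (Real.cos t : ℂ)) ((-Real.sin t : ℝ) : ℂ) t :=
      (Real.hasDerivAt_cos t).ofReal_comp
    have h1 := ((hs.pow (p + 2)).mul (((hc.const_sub z).inv hne).pow (p + 2)))
    refine h1.congr_deriv ?_
    have hsc : (Real.sin t : ℂ) ^ 2 = 1 - (Real.cos t : ℂ) ^ 2 := by
      rw [← Complex.ofReal_pow, Real.sin_sq]; simp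
    have hA : (z - (Real.cos t : ℂ))⁻¹ * (z - (Real.cos t : ℂ)) = 1 := inv_mul_cancel₀ hne
    have e1 : p + 2 - 1 = p + 1 := rfl
    have e2 : -((-Real.sin t : ℝ) : ℂ) = (Real.sin t : ℂ) := by simp
    simp only [Pi.pow_apply, Pi.inv_apply, e1, e2, div_eq_mul_inv, ← inv_pow]
    push_cast only [Nat.cast_add, Nat.cast_ofNat]
    generalize (z - (Real.cos t : ℂ))⁻¹ = A at *
    generalize (Real.sin t : ℂ) = S at *
    generalize (Real.cos t : ℂ) = C at *
    linear_combination ((p : ℂ) + 2) * S ^ (p + 1) * A ^ (p + 2) * (-(z + C) * hA - A * hsc)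
  have hi1 := (continuous_cauchySin_integrand (p + 1) (p + 2) hz).intervalIntegrable
    (μ := volume) 0 Real.pi
  have hi2 := (continuous_cauchySin_integrand (p + 1) (p + 3) hz).intervalIntegrable
    (μ := volume) 0 Real.pi
  have := intervalIntegral.integral_eq_sub_of_hasDerivAt hder
    (((hi2.const_mul (z ^ 2 - 1)).sub (hi1.const_mul z)).const_mul _)
  rw [intervalIntegral.integral_const_mul, intervalIntegral.integral_sub
    (hi2.const_mul (z ^ 2 - 1)) (hi1.const_mul z), intervalIntegral.integral_const_mul,
    intervalIntegral.integral_const_mul] at this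
  simp only [Real.sin_pi, Real.sin_zero, Complex.ofReal_zero, ne_eq, Nat.add_eq_zero_iff,
    OfNat.ofNat_ne_zero, and_false, not_false_eq_true, zero_pow, zero_mul, sub_zero] at this
  have hp : ((p : ℂ) + 2) ≠ 0 := by exact_mod_cast (Nat.succ_ne_zero (p + 1))
  rcases mul_eq_zero.1 this with h | h
  · exact absurd h hp
  · exact sub_eq_zero.1 h

/-- The branch of `√(1 - z²)` on the upper half plane that is positive on the imaginary axis. -/
noncomputable def sqrtOneSub (z : ℂ) : ℂ := (1 - z ^ 2) ^ (1 / 2 : ℂ)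

theorem sqrtOneSub_sq (z : ℂ) : sqrtOneSub z ^ 2 = 1 - z ^ 2 := by
  rw [sqrtOneSub, ← Complex.cpow_nat_mul]
  norm_num

/-- If 1 - z² were real and nonpositive, then Im z ≠ 0 would force Re z = 0, whence 1 - z² = 1 + (Im
z)² > 0. The principal square root is thus holomorphic on the half plane. -/
theorem one_sub_sq_mem_slitPlane {z : ℂ} (hz : 0 < z.im) : 1 - z ^ 2 ∈ Complex.slitPlane := by
  rw [Complex.mem_slitPlane_iff]
  by_contra! h
  simp only [Complex.sub_re, Complex.sub_im, Complex.one_re, Complex.one_im, pow_two,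
    Complex.mul_re, Complex.mul_im] at h
  have h1 : z.re = 0 := by
    have : z.im * z.re = 0 := by linarith [h.2]
    exact (mul_eq_zero.1 this).resolve_left hz.ne'
  rw [h1] at h
  nlinarith [h.1]

theorem sqrtOneSub_ne_zero {z : ℂ} (hz : 0 < z.im) : sqrtOneSub z ≠ 0 := by
  intro h
  have := sqrtOneSub_sq z
  rw [h] at this
  exact Complex.slitPlane_ne_zero (one_sub_sq_mem_slitPlane hz) (by rw [← this]; simp)

theorem hasDerivAt_sqrtOneSub {z : ℂ} (hz : 0 < z.im) :
    HasDerivAt sqrtOneSub (-z / sqrtOneSub z) z := by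
  have h1 : HasDerivAt (fun z : ℂ => 1 - z ^ 2) (-(2 * z)) z := by
    simpa using (hasDerivAt_pow 2 z).const_sub 1
  have h2 := h1.cpow_const (c := (1 / 2 : ℂ)) (one_sub_sq_mem_slitPlane hz)
  refine h2.congr_deriv ?_
  have h0 := Complex.slitPlane_ne_zero (one_sub_sq_mem_slitPlane hz)
  rw [Complex.cpow_sub _ _ h0, Complex.cpow_one]
  have hq := sqrtOneSub_ne_zero hz
  have hsq := sqrtOneSub_sq z
  rw [← sqrtOneSub, ← hsq]
  field_simp

end Stieltjes

end SphericalMeans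

namespace SphericalMeans

/-! ### Closed form and boundary values of the transform -/

section StieltjesLimit

/-- Wallis' recursions for the two integrals cancel in the product with p + 1, so the value depends
on p only through the two base cases, which agree. -/
theorem integral_sin_pow_mul_integral_cos_pow (p : ℕ) :
    (p + 1) * ((∫ t in (0 : ℝ)..Real.pi, Real.sin t ^ (p + 1)) *
      ∫ t in (0 : ℝ)..(Real.pi / 2), Real.cos t ^ p) = Real.pi := by
  induction p using Nat.twoStepInduction with
  | zero => norm_num; ring
  | one => norm_num; ring
  | more p ih _ =>
    have h1 := integral_sin_pow (a := 0) (b := Real.pi) (p + 1)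
    have h2 := integral_cos_pow (a := 0) (b := Real.pi / 2) p
    simp only [Real.sin_pi, Real.sin_zero, Real.cos_pi_div_two] at h1 h2
    norm_num at h1 h2
    rw [show p + 2 + 1 = p + 1 + 2 by ring, h1, h2]
    push_cast
    have h3 : (p : ℝ) + 2 ≠ 0 := by positivity
    have h4 : (p : ℝ) + 1 + 2 ≠ 0 := by positivity
    generalize (∫ t in (0 : ℝ)..Real.pi, Real.sin t ^ (p + 1)) = a at *
    generalize (∫ t in (0 : ℝ)..(Real.pi / 2), Real.cos t ^ p) = b at *
    field_simp
    linear_combination ((p : ℝ) + 2) * (p + 3) * ih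

theorem im_ofReal_add_mul_I (x y : ℝ) : ((x : ℂ) + y * Complex.I).im = y := by simp

/-- Both factors of 1 - z² = (1 - z)(1 + z) have modulus at least 1 - |Re z|. The bound is uniform
in Im z, as the limit onto the real axis requires. -/
theorem norm_sqrtOneSub_ge {z : ℂ} (hz : |z.re| < 1) : 1 - |z.re| ≤ ‖sqrtOneSub z‖ := by
  have h1 : ‖sqrtOneSub z‖ ^ 2 = ‖1 - z‖ * ‖1 + z‖ := by
    rw [← norm_pow, sqrtOneSub_sq, ← norm_mul]
    congr 1; ring
  have h2 : 1 - |z.re| ≤ ‖1 - z‖ := by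
    have := (Complex.re_le_norm (1 - z))
    simp only [Complex.sub_re, Complex.one_re] at this
    linarith [le_abs_self z.re]
  have h3 : 1 - |z.re| ≤ ‖1 + z‖ := by
    have := (Complex.re_le_norm (1 + z))
    simp only [Complex.add_re, Complex.one_re] at this
    linarith [neg_abs_le z.re]
  refine abs_le_of_sq_le_sq' ?_ (norm_nonneg _) |>.2
  rw [h1, pow_two]
  exact mul_le_mul h2 h3 (by linarith) (norm_nonneg _)

theorem sqrtOneSub_mul_I (y : ℝ) : sqrtOneSub (y * Complex.I) = (Real.sqrt (1 + y ^ 2) : ℝ) := by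
  rw [sqrtOneSub, mul_pow, Complex.I_sq, Real.sqrt_eq_rpow, Complex.ofReal_cpow (by positivity)]
  push_cast
  congr 1
  ring

theorem tendsto_sqrtOneSub {x : ℝ} (hx : |x| < 1) :
    Tendsto (fun y : ℝ => sqrtOneSub (x + y * Complex.I)) (𝓝[>] 0) (𝓝 (Real.sqrt (1 - x ^ 2) : ℝ)) := by
  have h1 : 0 < 1 - x ^ 2 := by
    have := (sq_lt_one_iff_abs_lt_one x).2 hx
    linarith
  have h2 : sqrtOneSub x = (Real.sqrt (1 - x ^ 2) : ℝ) := by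
    rw [sqrtOneSub, Real.sqrt_eq_rpow, Complex.ofReal_cpow h1.le]
    push_cast
    rfl
  have h3 : ContinuousAt (fun y : ℝ => sqrtOneSub (x + y * Complex.I)) 0 := by
    unfold sqrtOneSub
    refine ContinuousAt.cpow (by fun_prop) continuousAt_const ?_
    refine Complex.mem_slitPlane_iff.2 (Or.inl ?_)
    simpa [← Complex.ofReal_pow] using h1
  have h4 := h3.tendsto
  simp only [Complex.ofReal_zero, zero_mul, add_zero, h2] at h4
  exact h4.mono_left nhdsWithin_le_nhds

/-- `i^{-(p+2)} ∫_0^π sin^{p+1}`. -/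
noncomputable def stieltjesConst (p : ℕ) : ℂ :=
  (-Complex.I) ^ (p + 2) * (∫ t in (0 : ℝ)..Real.pi, Real.sin t ^ (p + 1) : ℝ)

/-- Along z = iy the quotient √(1 - z²)/(z - c) tends to 1/i = -i for each real c, boundedly for y ≥
1. This fixes the constant in the closed form of the transform. -/
theorem tendsto_cauchySin_mul (p : ℕ) :
    Tendsto (fun y : ℝ => cauchySin (p + 1) (p + 2) (y * Complex.I) *
      sqrtOneSub (y * Complex.I) ^ (p + 2)) atTop (𝓝 (stieltjesConst p)) := by
  have hlim : ∀ c : ℝ, Tendsto (fun y : ℝ => sqrtOneSub (y * Complex.I) *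
      (y * Complex.I - c)⁻¹) atTop (𝓝 (-Complex.I)) := by
    intro c
    have h0 : Tendsto (fun y : ℝ => y⁻¹) atTop (𝓝 0) := tendsto_inv_atTop_zero
    have h1 : Tendsto (fun y : ℝ => ((Real.sqrt ((y⁻¹) ^ 2 + 1) : ℝ) : ℂ) *
        (Complex.I - c * (y⁻¹ : ℝ))⁻¹) atTop (𝓝 (-Complex.I)) := by
      have a1 : Tendsto (fun y : ℝ => ((Real.sqrt ((y⁻¹) ^ 2 + 1) : ℝ) : ℂ)) atTop (𝓝 1) := by
        have : ContinuousAt (fun s : ℝ => ((Real.sqrt (s ^ 2 + 1) : ℝ) : ℂ)) 0 := by fun_prop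
        simpa [Function.comp_def] using this.tendsto.comp h0
      have a2 : Tendsto (fun y : ℝ => (Complex.I - c * (y⁻¹ : ℝ))⁻¹) atTop (𝓝 (-Complex.I)) := by
        have : ContinuousAt (fun s : ℝ => (Complex.I - c * (s : ℝ))⁻¹) 0 := by
          refine ContinuousAt.inv₀ (by fun_prop) ?_
          simp
        simpa [Function.comp_def] using this.tendsto.comp h0
      simpa using a1.mul a2
    refine h1.congr' ?_
    filter_upwards [eventually_gt_atTop 0] with y hy
    have h2 : Real.sqrt ((y⁻¹) ^ 2 + 1) = Real.sqrt (1 + y ^ 2) * y⁻¹ := by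
      rw [show (y⁻¹) ^ 2 + 1 = (1 + y ^ 2) * (y⁻¹) ^ 2 by field_simp, Real.sqrt_mul (by positivity),
        Real.sqrt_sq (by positivity)]
    have h3 : (y : ℂ) ≠ 0 := by exact_mod_cast hy.ne'
    have h4 : Complex.I - c * ((y⁻¹ : ℝ) : ℂ) = (y * Complex.I - c) * (y : ℂ)⁻¹ := by
      push_cast; field_simp
    rw [sqrtOneSub_mul_I, h2, h4, mul_inv, inv_inv]
    push_cast
    field_simp
  have e1 : ∀ y : ℝ, cauchySin (p + 1) (p + 2) (y * Complex.I) * sqrtOneSub (y * Complex.I) ^ (p + 2)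
      = ∫ t in (0 : ℝ)..Real.pi, (Real.sin t : ℂ) ^ (p + 1) *
        (sqrtOneSub (y * Complex.I) * (y * Complex.I - Real.cos t)⁻¹) ^ (p + 2) := by
    intro y
    rw [cauchySin, ← intervalIntegral.integral_mul_const]
    refine intervalIntegral.integral_congr fun t _ => ?_
    simp only [mul_pow]
    ring
  have e2 : stieltjesConst p = ∫ t in (0 : ℝ)..Real.pi, (Real.sin t : ℂ) ^ (p + 1) *
      (-Complex.I) ^ (p + 2) := by
    rw [intervalIntegral.integral_mul_const, stieltjesConst, mul_comm]
    congr 1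
    rw [← intervalIntegral.integral_ofReal]
    simp
  rw [e2]
  simp_rw [e1]
  refine intervalIntegral.tendsto_integral_filter_of_dominated_convergence (fun _ => 2 ^ (p + 2))
    ?_ ?_ ?_ ?_
  · filter_upwards [eventually_gt_atTop 0] with y hy
    have him : 0 < ((y : ℂ) * Complex.I).im := by simpa using hy
    refine Continuous.aestronglyMeasurable ?_
    refine Continuous.mul (by fun_prop) ((continuous_const.mul
      (Continuous.inv₀ (by fun_prop) fun t => sub_ofReal_ne_zero him _)).pow _)
  · filter_upwards [eventually_ge_atTop 1] with y hy
    refine ae_of_all _ fun t _ => ?_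
    have hy0 : 0 < y := by linarith
    have him : 0 < ((y : ℂ) * Complex.I).im := by simpa using hy0
    have h1 : ‖((Real.sin t : ℝ) : ℂ)‖ ^ (p + 1) ≤ 1 := by
      rw [Complex.norm_real]
      exact pow_le_one₀ (norm_nonneg _) (Real.abs_sin_le_one t)
    have h2 : ‖sqrtOneSub (y * Complex.I) * (y * Complex.I - Real.cos t)⁻¹‖ ≤ 2 := by
      rw [norm_mul, sqrtOneSub_mul_I, Complex.norm_real, Real.norm_of_nonneg (Real.sqrt_nonneg _)]
      have a1 : Real.sqrt (1 + y ^ 2) ≤ 2 * y := Real.sqrt_le_iff.2 ⟨by linarith, by nlinarith⟩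
      have a2 := norm_inv_sub_ofReal_le him (Real.cos t)
      rw [show ((y : ℂ) * Complex.I).im = y by simp] at a2
      calc _ ≤ (2 * y) * y⁻¹ := by gcongr
        _ = 2 := by field_simp
    rw [norm_mul, norm_pow, norm_pow]
    calc _ ≤ 1 * (2 : ℝ) ^ (p + 2) := by gcongr
      _ = _ := one_mul _
  · exact intervalIntegrable_const
  · exact ae_of_all _ fun t _ => ((hlim (Real.cos t)).pow _).const_mul _

/-- By the recurrence, the product of the transform with (1 - z²)^{(p+2)/2} has zero derivative on
the connected half plane; its value is read off at i∞. -/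
theorem cauchySin_eq (p : ℕ) {z : ℂ} (hz : 0 < z.im) :
    cauchySin (p + 1) (p + 2) z = stieltjesConst p / sqrtOneSub z ^ (p + 2) := by
  set H : ℂ → ℂ := fun z => cauchySin (p + 1) (p + 2) z * sqrtOneSub z ^ (p + 2) with hH
  have hopen : IsOpen {z : ℂ | 0 < z.im} := isOpen_lt continuous_const Complex.continuous_im
  have hconn : IsPreconnected {z : ℂ | 0 < z.im} := (convex_halfSpace_im_gt 0).isPreconnected
  have hder : ∀ z : ℂ, 0 < z.im → HasDerivAt H 0 z := by
    intro z hz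
    have h1 := (hasDerivAt_cauchySin (p + 1) (p + 2) hz).mul
      ((hasDerivAt_sqrtOneSub hz).pow (p + 2))
    refine h1.congr_deriv ?_
    have hq := sqrtOneSub_ne_zero hz
    have hrec := cauchySin_recurrence p hz
    have hsq := sqrtOneSub_sq z
    have e1 : p + 2 - 1 = p + 1 := rfl
    have e2 : -z / sqrtOneSub z * sqrtOneSub z = -z := by field_simp
    simp only [Pi.pow_apply, e1]
    push_cast only [Nat.cast_add, Nat.cast_ofNat]
    generalize sqrtOneSub z = q at *
    generalize cauchySin (p + 1) (p + 2) z = a at *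
    rw [show p + 2 + 1 = p + 3 from rfl]
    generalize cauchySin (p + 1) (p + 3) z = c at *
    generalize -z / q = d at *
    linear_combination ((p : ℂ) + 2) * q ^ p * (a * e2 - c * hsq + hrec)
  have hconst : ∀ w : ℂ, 0 < w.im → H w = H z := fun w hw =>
    hopen.is_const_of_deriv_eq_zero hconn
      (fun z hz => (hder z hz).differentiableAt.differentiableWithinAt)
      (fun z hz => (hder z hz).deriv) hw hz
  have hHz : H z = stieltjesConst p := by
    refine tendsto_nhds_unique (tendsto_const_nhds.congr' ?_) (tendsto_cauchySin_mul p)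
    filter_upwards [eventually_gt_atTop 0] with y hy
    exact (hconst _ (by simpa using hy)).symm
  have hq := sqrtOneSub_ne_zero hz
  rw [← hHz, hH]
  field_simp

/-- Along the imaginary axis the derivative is a constant times (1 + y²)^{-(p+2)/2}, and y = tan t
turns this into cos^p t dt. Decay as y → ∞ fixes the integration constant. -/
theorem cauchySin_mul_I (p : ℕ) {y : ℝ} (hy : 0 < y) :
    cauchySin (p + 1) (p + 1) (y * Complex.I) = Complex.I * (p + 1) * stieltjesConst p *
      ((∫ t in (0 : ℝ)..(Real.pi / 2), Real.cos t ^ p) -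
        ∫ t in (0 : ℝ)..Real.arctan y, Real.cos t ^ p : ℝ) := by
  set V : ℝ → ℝ := fun a => ∫ t in (0 : ℝ)..a, Real.cos t ^ p with hV
  have hVd : ∀ a, HasDerivAt V (Real.cos a ^ p) a := fun a =>
    intervalIntegral.integral_hasDerivAt_right
      (Continuous.intervalIntegrable (by fun_prop) _ _)
      (Continuous.stronglyMeasurableAtFilter (by fun_prop) _ _) (by fun_prop)
  set c : ℂ := Complex.I * (p + 1) * stieltjesConst p with hc
  set H : ℝ → ℂ := fun y => cauchySin (p + 1) (p + 1) (y * Complex.I) +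
    c * (V (Real.arctan y) : ℝ) with hH
  have hder : ∀ y : ℝ, 0 < y → HasDerivAt H 0 y := by
    intro y hy
    have him : 0 < ((y : ℂ) * Complex.I).im := by simpa using hy
    have h1 : HasDerivAt (fun y : ℝ => (y : ℂ) * Complex.I) Complex.I y := by
      simpa using (Complex.ofRealCLM.hasDerivAt (x := y)).mul_const Complex.I
    have h2 := (hasDerivAt_cauchySin (p + 1) (p + 1) him).comp y h1
    have h3 := (((hVd (Real.arctan y)).comp y (Real.hasDerivAt_arctan y)).ofReal_comp).const_mul c
    refine (h2.add h3).congr_deriv ?_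
    rw [cauchySin_eq p him, sqrtOneSub_mul_I, Real.cos_arctan, hc]
    have h4 : 0 < Real.sqrt (1 + y ^ 2) := Real.sqrt_pos.2 (by positivity)
    have h5 : ((Real.sqrt (1 + y ^ 2) : ℝ) : ℂ) ≠ 0 := by exact_mod_cast h4.ne'
    have h6 : 1 + y ^ 2 = Real.sqrt (1 + y ^ 2) ^ 2 := (Real.sq_sqrt (by positivity)).symm
    have h7 : (1 / Real.sqrt (1 + y ^ 2)) ^ p * (1 / (1 + y ^ 2)) =
        1 / Real.sqrt (1 + y ^ 2) ^ (p + 2) := by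
      nth_rewrite 2 [h6]
      rw [pow_add, one_div_pow]
      field_simp
    rw [h7]
    push_cast
    field_simp
    ring
  have hconst : ∀ w : ℝ, 0 < w → H w = H y := fun w hw =>
    isOpen_Ioi.is_const_of_deriv_eq_zero (isPreconnected_Ioi (a := (0 : ℝ)))
      (fun z hz => (hder z hz).differentiableAt.differentiableWithinAt)
      (fun z hz => (hder z hz).deriv) hw hy
  have hlim : Tendsto H atTop (𝓝 (0 + c * (V (Real.pi / 2) : ℝ))) := by
    refine Tendsto.add ?_ (Tendsto.const_mul c ?_)
    · rw [tendsto_zero_iff_norm_tendsto_zero]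
      have h0 : Tendsto (fun y : ℝ => y⁻¹ ^ (p + 1) * |Real.pi - 0|) atTop (𝓝 0) := by
        simpa using ((tendsto_inv_atTop_zero (𝕜 := ℝ)).pow (p + 1)).mul_const |Real.pi - 0|
      refine squeeze_zero' (Eventually.of_forall fun _ => norm_nonneg _) ?_ h0
      filter_upwards [eventually_gt_atTop 0] with y hy
      refine intervalIntegral.norm_integral_le_of_norm_le_const fun t _ => ?_
      have him : 0 < ((y : ℂ) * Complex.I).im := by simpa using hy
      have h1 : ‖((Real.sin t : ℝ) : ℂ)‖ ^ (p + 1) ≤ 1 := by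
        rw [Complex.norm_real]
        exact pow_le_one₀ (norm_nonneg _) (Real.abs_sin_le_one t)
      have a2 := norm_inv_sub_ofReal_le him (Real.cos t)
      rw [show ((y : ℂ) * Complex.I).im = y by simp] at a2
      rw [norm_mul, norm_pow, norm_pow]
      calc _ ≤ 1 * y⁻¹ ^ (p + 1) := by gcongr
        _ = _ := one_mul _
    · have h1 : Tendsto Real.arctan atTop (𝓝 (Real.pi / 2)) :=
        Real.tendsto_arctan_atTop.mono_right nhdsWithin_le_nhds
      exact (Complex.continuous_ofReal.tendsto _).comp ((hVd _).continuousAt.tendsto.comp h1)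
  have hHy : H y = c * (V (Real.pi / 2) : ℝ) := by
    rw [zero_add] at hlim
    refine tendsto_nhds_unique (tendsto_const_nhds.congr' ?_) hlim
    filter_upwards [eventually_gt_atTop 0] with w hw
    exact (hconst w hw).symm
  have : cauchySin (p + 1) (p + 1) (y * Complex.I) = H y - c * (V (Real.arctan y) : ℝ) := by
    simp [hH]
  rw [this, hHy]
  push_cast
  ring

theorem I_mul_stieltjesConst (p : ℕ) : Complex.I * (p + 1) * stieltjesConst p *
    (∫ t in (0 : ℝ)..(Real.pi / 2), Real.cos t ^ p : ℝ) = Real.pi * (-Complex.I) ^ (p + 1) := by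
  have h := congrArg (fun x : ℝ => (x : ℂ)) (integral_sin_pow_mul_integral_cos_pow p)
  push_cast at h
  rw [← h, stieltjesConst, pow_succ _ (p + 1)]
  linear_combination (-(-Complex.I) ^ (p + 1) * (p + 1) *
    (∫ t in (0 : ℝ)..Real.pi, Real.sin t ^ (p + 1) : ℝ) *
    (∫ t in (0 : ℝ)..(Real.pi / 2), Real.cos t ^ p : ℝ)) * Complex.I_sq

/-- The derivative of the transform of order p + 1 is a multiple of the one of order p + 2, which is
known in closed form; it is integrated along the horizontal segment from iy to h + iy. -/
theorem cauchySin_eq_add_integral (p : ℕ) (h : ℝ) {y : ℝ} (hy : 0 < y) :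
    cauchySin (p + 1) (p + 1) (h + y * Complex.I) = cauchySin (p + 1) (p + 1) (y * Complex.I) +
      ∫ x in (0 : ℝ)..h, -(p + 1) * (stieltjesConst p / sqrtOneSub (x + y * Complex.I) ^ (p + 2)) := by
  have him : ∀ x : ℝ, 0 < ((x : ℂ) + y * Complex.I).im := fun x => by simpa using hy
  have hder : ∀ x ∈ uIcc 0 h, HasDerivAt (fun x : ℝ => cauchySin (p + 1) (p + 1) (x + y * Complex.I))
      (-(p + 1) * (stieltjesConst p / sqrtOneSub (x + y * Complex.I) ^ (p + 2))) x := by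
    intro x _
    have h1 : HasDerivAt (fun x : ℝ => (x : ℂ) + y * Complex.I) 1 x := by
      simpa using (Complex.ofRealCLM.hasDerivAt (x := x)).add_const (y * Complex.I)
    have h2 := (hasDerivAt_cauchySin (p + 1) (p + 1) (him x)).comp x h1
    refine h2.congr_deriv ?_
    rw [cauchySin_eq p (him x)]
    push_cast
    ring
  have hcont : Continuous fun x : ℝ => sqrtOneSub (x + y * Complex.I) := by
    refine continuous_iff_continuousAt.2 fun x => ?_
    exact ContinuousAt.comp (f := fun x : ℝ => (x : ℂ) + y * Complex.I)
      (hasDerivAt_sqrtOneSub (him x)).continuousAt (by fun_prop)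
  have := intervalIntegral.integral_eq_sub_of_hasDerivAt hder (Continuous.intervalIntegrable
    (continuous_const.mul (continuous_const.div (hcont.pow _)
      fun x => pow_ne_zero _ (sqrtOneSub_ne_zero (him x)))) _ _)
  rw [this]
  simp

theorem norm_div_sqrtOneSub_le (p : ℕ) {ρ x : ℝ} (hρ : ρ < 1) (hx : |x| ≤ ρ) (y : ℝ) :
    ‖-((p : ℂ) + 1) * (stieltjesConst p / sqrtOneSub (x + y * Complex.I) ^ (p + 2))‖ ≤
      (p + 1) * (‖stieltjesConst p‖ / (1 - ρ) ^ (p + 2)) := by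
  have h1 : 1 - ρ ≤ ‖sqrtOneSub (x + y * Complex.I)‖ := by
    have := norm_sqrtOneSub_ge (z := x + y * Complex.I) (by simpa using hx.trans_lt hρ)
    simp at this
    linarith
  have h2 : ‖-((p : ℂ) + 1)‖ = p + 1 := by
    rw [norm_neg]; exact_mod_cast Complex.norm_natCast (p + 1)
  rw [norm_mul, norm_div, norm_pow, h2]
  have : 0 < 1 - ρ := by linarith
  gcongr

/-- Uniformity over all y > 0, not only small y, is essential: the bound is applied at height
ε/(2R|x-y|), which is unbounded as y approaches x. -/
theorem norm_cauchySin_le (p : ℕ) {ρ : ℝ} (hρ : ρ < 1) : ∃ B, ∀ h : ℝ, |h| ≤ ρ → ∀ y : ℝ, 0 < y →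
    ‖cauchySin (p + 1) (p + 1) (h + y * Complex.I)‖ ≤ B := by
  refine ⟨‖Complex.I * (p + 1) * stieltjesConst p‖ * Real.pi +
    (p + 1) * (‖stieltjesConst p‖ / (1 - ρ) ^ (p + 2)) * 1, fun h hh y hy => ?_⟩
  rw [cauchySin_eq_add_integral p h hy, cauchySin_mul_I p hy]
  refine (norm_add_le _ _).trans (add_le_add ?_ ?_)
  · rw [norm_mul]
    gcongr
    rw [Complex.norm_real, intervalIntegral.integral_interval_sub_left
      (Continuous.intervalIntegrable (by fun_prop) _ _)
      (Continuous.intervalIntegrable (by fun_prop) _ _)]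
    have h1 : ‖∫ t in Real.arctan y..Real.pi / 2, Real.cos t ^ p‖ ≤ 1 * |Real.pi / 2 - Real.arctan y| := by
      refine intervalIntegral.norm_integral_le_of_norm_le_const fun t _ => ?_
      rw [norm_pow]
      exact pow_le_one₀ (norm_nonneg _) (Real.abs_cos_le_one t)
    have h2 := Real.arctan_lt_pi_div_two y
    have h3 := Real.arctan_pos.2 hy
    rw [one_mul, abs_of_pos (by linarith)] at h1
    linarith [Real.pi_pos]
  · have h1 : ‖∫ x in (0 : ℝ)..h, -((p : ℂ) + 1) *
        (stieltjesConst p / sqrtOneSub (x + y * Complex.I) ^ (p + 2))‖ ≤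
        (p + 1) * (‖stieltjesConst p‖ / (1 - ρ) ^ (p + 2)) * |h - 0| := by
      refine intervalIntegral.norm_integral_le_of_norm_le_const fun x hx => ?_
      refine norm_div_sqrtOneSub_le p hρ ?_ y
      refine le_trans ?_ hh
      rcases uIoc_subset_uIcc hx with ⟨h1, h2⟩
      rcases le_total 0 h with h0 | h0
      · rw [abs_of_nonneg h0]; rw [inf_eq_left.2 h0] at h1; rw [sup_eq_right.2 h0] at h2
        rwa [abs_of_nonneg h1]
      · rw [abs_of_nonpos h0]; rw [inf_eq_right.2 h0] at h1; rw [sup_eq_left.2 h0] at h2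
        rw [abs_of_nonpos h2]; linarith
    refine h1.trans ?_
    have : 0 < 1 - ρ := by linarith
    gcongr
    rw [sub_zero]
    linarith

/-- Boundary values on `(-1, 1)` of the Stieltjes transform. -/
theorem tendsto_cauchySin (p : ℕ) (T : ℂ →L[ℝ] ℝ)
    (hT : ∀ r : ℝ, T ((-Complex.I) ^ (p + 2) * r) = 0) {h : ℝ} (hh : |h| < 1) :
    Tendsto (fun y : ℝ => T (cauchySin (p + 1) (p + 1) (h + y * Complex.I))) (𝓝[>] 0)
      (𝓝 (Real.pi * T ((-Complex.I) ^ (p + 1)))) := by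
  -- The value above h = 0: at y = 0 the arctangent integral disappears and the Wallis product
  -- leaves π(-i)^{p+1}.
  have hJ : Tendsto (fun y : ℝ => cauchySin (p + 1) (p + 1) (y * Complex.I)) (𝓝[>] 0)
      (𝓝 (Real.pi * (-Complex.I) ^ (p + 1))) := by
    have h1 : Continuous fun y : ℝ => ∫ t in (0 : ℝ)..Real.arctan y, Real.cos t ^ p :=
      (intervalIntegral.continuous_primitive
        (fun a b => Continuous.intervalIntegrable (by fun_prop) a b) 0).comp Real.continuous_arctan
    have h2 : Tendsto (fun y : ℝ => Complex.I * (p + 1) * stieltjesConst p *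
      ((∫ t in (0 : ℝ)..(Real.pi / 2), Real.cos t ^ p) -
        ∫ t in (0 : ℝ)..Real.arctan y, Real.cos t ^ p : ℝ)) (𝓝 0)
        (𝓝 (Real.pi * (-Complex.I) ^ (p + 1))) := by
      have : Continuous fun y : ℝ => Complex.I * (p + 1) * stieltjesConst p *
        ((∫ t in (0 : ℝ)..(Real.pi / 2), Real.cos t ^ p) -
          ∫ t in (0 : ℝ)..Real.arctan y, Real.cos t ^ p : ℝ) :=
        continuous_const.mul (Complex.continuous_ofReal.comp (continuous_const.sub h1))
      have h3 := this.tendsto 0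
      simp only [Real.arctan_zero, intervalIntegral.integral_same, sub_zero,
        I_mul_stieltjesConst] at h3
      exact h3
    refine (h2.mono_left nhdsWithin_le_nhds).congr' ?_
    filter_upwards [self_mem_nhdsWithin] with y hy
    exact (cauchySin_mul_I p hy).symm
  have hint : Tendsto (fun y : ℝ => ∫ x in (0 : ℝ)..h, -((p : ℂ) + 1) *
      (stieltjesConst p / sqrtOneSub (x + y * Complex.I) ^ (p + 2))) (𝓝[>] 0)
      (𝓝 (∫ x in (0 : ℝ)..h, -((p : ℂ) + 1) *
        (stieltjesConst p / (Real.sqrt (1 - x ^ 2) : ℝ) ^ (p + 2)))) := by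
    have habs : ∀ x ∈ uIoc 0 h, |x| ≤ |h| := by
      intro x hx
      rcases uIoc_subset_uIcc hx with ⟨h1, h2⟩
      rcases le_total 0 h with h0 | h0
      · rw [abs_of_nonneg h0]; rw [inf_eq_left.2 h0] at h1; rw [sup_eq_right.2 h0] at h2
        rwa [abs_of_nonneg h1]
      · rw [abs_of_nonpos h0]; rw [inf_eq_right.2 h0] at h1; rw [sup_eq_left.2 h0] at h2
        rw [abs_of_nonpos h2]; linarith
    refine intervalIntegral.tendsto_integral_filter_of_dominated_convergence
      (fun _ => (p + 1) * (‖stieltjesConst p‖ / (1 - |h|) ^ (p + 2))) ?_ ?_ ?_ ?_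
    · filter_upwards [self_mem_nhdsWithin] with y (hy : 0 < y)
      have him : ∀ x : ℝ, 0 < ((x : ℂ) + y * Complex.I).im := fun x => by simpa using hy
      have hcont : Continuous fun x : ℝ => sqrtOneSub (x + y * Complex.I) := by
        refine continuous_iff_continuousAt.2 fun x => ?_
        exact ContinuousAt.comp (f := fun x : ℝ => (x : ℂ) + y * Complex.I)
          (hasDerivAt_sqrtOneSub (him x)).continuousAt (by fun_prop)
      exact (continuous_const.mul (continuous_const.div (hcont.pow _)
        fun x => pow_ne_zero _ (sqrtOneSub_ne_zero (him x)))).aestronglyMeasurable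
    · exact Eventually.of_forall fun y => ae_of_all _ fun x hx =>
        norm_div_sqrtOneSub_le p hh (habs x hx) y
    · exact intervalIntegrable_const
    · refine ae_of_all _ fun x hx => ?_
      have hx1 := (habs x hx).trans_lt hh
      refine ((tendsto_const_nhds.div ((tendsto_sqrtOneSub hx1).pow _) ?_)).const_mul _
      have : 0 < Real.sqrt (1 - x ^ 2) := by
        refine Real.sqrt_pos.2 ?_
        have := (sq_lt_one_iff_abs_lt_one x).2 hx1
        linarith
      exact pow_ne_zero _ (by exact_mod_cast this.ne')
  -- On (-1, 1) the square root is real, so the increment from 0 to h is a real multiple of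
  -- (-i)^{p+2} and T kills it. This is where the parity of the dimension enters.
  have hzero : T (∫ x in (0 : ℝ)..h, -((p : ℂ) + 1) *
      (stieltjesConst p / (Real.sqrt (1 - x ^ 2) : ℝ) ^ (p + 2))) = 0 := by
    set r : ℝ → ℝ := fun x => -((p : ℝ) + 1) *
      ((∫ t in (0 : ℝ)..Real.pi, Real.sin t ^ (p + 1)) / Real.sqrt (1 - x ^ 2) ^ (p + 2)) with hr
    have : ∀ x : ℝ, -((p : ℂ) + 1) * (stieltjesConst p / (Real.sqrt (1 - x ^ 2) : ℝ) ^ (p + 2)) =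
        (-Complex.I) ^ (p + 2) * (r x : ℝ) := by
      intro x
      rw [stieltjesConst, hr]
      push_cast
      ring
    simp_rw [this]
    rw [intervalIntegral.integral_const_mul, intervalIntegral.integral_ofReal, hT]
  have h1 := (T.continuous.tendsto _).comp (hJ.add hint)
  rw [map_add, hzero, add_zero] at h1
  have h2 : T (Real.pi * (-Complex.I) ^ (p + 1)) = Real.pi * T ((-Complex.I) ^ (p + 1)) := by
    rw [← Complex.real_smul, map_smul, smul_eq_mul]
  rw [h2] at h1
  refine h1.congr' ?_
  filter_upwards [self_mem_nhdsWithin] with y hy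
  simp only [Function.comp_apply]
  rw [cauchySin_eq_add_integral p h hy]

end StieltjesLimit

end SphericalMeans

namespace SphericalMeans

/-! ### Integrals of zonal functions over the sphere -/

section Zonal

open scoped RealInnerProductSpace

theorem integrable_exp_neg_norm_sq (m : ℕ) : Integrable fun x : E m => Real.exp (-‖x‖ ^ 2) := by
  have := (GaussianFourier.integrable_cexp_neg_mul_sq_norm_add (V := E m) (b := 1) (by simp) 0 0).norm
  refine this.congr (ae_of_all _ fun x => ?_)
  simp only [Complex.norm_exp]
  congr 1
  simp [← Complex.ofReal_pow]

theorem integrableOn_pow_mul_exp_neg_sq (k : ℕ) :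
    IntegrableOn (fun r : ℝ => r ^ k * Real.exp (-r ^ 2)) (Ioi 0) := by
  have := integrableOn_rpow_mul_exp_neg_mul_sq (b := 1) one_pos (s := k)
    (by have : (0 : ℝ) ≤ k := k.cast_nonneg
        linarith)
  refine this.congr_fun (fun r _ => ?_) measurableSet_Ioi
  simp

theorem integral_pow_mul_exp_neg_sq_pos (k : ℕ) :
    0 < ∫ r in Ioi (0 : ℝ), r ^ k * Real.exp (-r ^ 2) := by
  rw [setIntegral_pos_iff_support_of_nonneg_ae]
  · have : Ioi (0 : ℝ) ⊆ Function.support (fun r : ℝ => r ^ k * Real.exp (-r ^ 2)) := by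
      intro r (hr : 0 < r)
      have : 0 < r ^ k * Real.exp (-r ^ 2) := by positivity
      exact this.ne'
    rw [inter_eq_right.2 this]
    simp
  · filter_upwards [ae_restrict_mem measurableSet_Ioi] with r (hr : 0 < r)
    simp only [Pi.zero_apply]
    positivity
  · exact integrableOn_pow_mul_exp_neg_sq k

/-- A unit vector is the first axis of a measure preserving splitting of the space. -/
theorem exists_measurableEquiv_split (m : ℕ) {e : E (m + 1)} (he : ‖e‖ = 1) :
    ∃ Ψ : E (m + 1) ≃ᵐ ℝ × (Fin m → ℝ), MeasurePreserving Ψ ∧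
      ∀ x, (Ψ x).1 = ⟪e, x⟫ ∧ ‖x‖ ^ 2 = (Ψ x).1 ^ 2 + ‖WithLp.toLp 2 (Ψ x).2‖ ^ 2 := by
  have hv : Orthonormal ℝ (({0} : Set (Fin (m + 1))).domRestrict fun _ => e) := by
    refine ⟨fun i => he, fun i j hij => ?_⟩
    exact absurd (Subtype.ext (i.2.trans j.2.symm)) hij
  obtain ⟨b, hb⟩ := hv.exists_orthonormalBasis_extension_of_card_eq (by simp)
  have hb0 : b 0 = e := hb 0 rfl
  refine ⟨(b.repr.toMeasurableEquiv.trans (MeasurableEquiv.toLp 2 (Fin (m + 1) → ℝ)).symm).trans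
    (MeasurableEquiv.piFinSuccAbove (fun _ => ℝ) 0), ?_, fun x => ⟨?_, ?_⟩⟩
  · exact (volume_preserving_piFinSuccAbove (fun _ => ℝ) 0).comp
      ((PiLp.volume_preserving_ofLp (Fin (m + 1))).comp b.measurePreserving_repr)
  · change b.repr x 0 = _
    rw [b.repr_apply_apply, hb0]
  · rw [← b.repr.norm_map x, EuclideanSpace.norm_sq_eq, EuclideanSpace.norm_sq_eq,
      Fin.sum_univ_succ]
    simp only [Real.norm_eq_abs, sq_abs]
    rfl

/-- The Gaussian-weighted integral of g(⟨e,x⟩/|x|) is computed twice: in polar coordinates of the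
whole space, and in cylindrical coordinates about e followed by polar coordinates in the half plane
(s, ρ). Both computations produce the same positive radial factor A = ∫ r^m e^{-r²} dr, which
cancels. -/
theorem integral_sphere_zonal {m : ℕ} (hm : m ≠ 0) {e : E (m + 1)} (he : ‖e‖ = 1) {g : ℝ → ℂ}
    (hg : Continuous g) {C : ℝ} (hC : ∀ s, ‖g s‖ ≤ C) :
    ∫ θ : sphere (0 : E (m + 1)) 1, g ⟪e, (θ : E (m + 1))⟫ ∂(unitSphereMeasure (m + 1)) =
      (m * volume.real (ball (0 : E m) 1)) •
        ∫ t in (0 : ℝ)..Real.pi, Real.sin t ^ (m - 1) • g (Real.cos t) := by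
  have : Nontrivial (E m) := by
    have : Nonempty (Fin m) := ⟨⟨0, Nat.pos_of_ne_zero hm⟩⟩
    infer_instance
  set A : ℝ := ∫ r in Ioi (0 : ℝ), r ^ m * Real.exp (-r ^ 2) with hA
  have hApos : 0 < A := integral_pow_mul_exp_neg_sq_pos m
  set G : E (m + 1) → ℂ := fun x => Real.exp (-‖x‖ ^ 2) • g (⟪e, x⟫ / ‖x‖) with hG
  have hGint : Integrable G := by
    refine (integrable_exp_neg_norm_sq (m + 1)).smul_bdd C ?_ (ae_of_all _ fun x => hC _)
    refine (hg.measurable.comp ?_).aestronglyMeasurable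
    exact Measurable.div (by fun_prop) (by fun_prop)
  -- polar coordinates
  have h1 : ∫ x, G x = A • ∫ θ : sphere (0 : E (m + 1)) 1, g ⟪e, (θ : E (m + 1))⟫
      ∂(unitSphereMeasure (m + 1)) := by
    rw [integral_polar (by omega) hGint, hA, ← integral_smul_const]
    refine setIntegral_congr_fun measurableSet_Ioi fun r (hr : 0 < r) => ?_
    have e1 : ∀ θ : sphere (0 : E (m + 1)) 1, G (r • (θ : E (m + 1))) =
        Real.exp (-r ^ 2) • g ⟪e, (θ : E (m + 1))⟫ := by
      intro θ
      have : ‖r • (θ : E (m + 1))‖ = r := by simp [norm_smul, abs_of_pos hr]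
      simp only [hG, this, inner_smul_right]
      rw [mul_div_cancel_left₀ _ hr.ne']
    simp only [e1, integral_smul, smul_smul, Nat.add_sub_cancel]
  -- cylindrical coordinates
  obtain ⟨Ψ, hΨ, hΨx⟩ := exists_measurableEquiv_split m he
  set F : ℝ → ℝ → ℂ := fun s ρ => Real.exp (-(s ^ 2 + ρ ^ 2)) • g (s / Real.sqrt (s ^ 2 + ρ ^ 2))
    with hF
  have hGF : ∀ x, G x = F (Ψ x).1 ‖WithLp.toLp 2 (Ψ x).2‖ := by
    intro x
    rw [hF]
    simp only
    rw [← (hΨx x).2, (hΨx x).1, Real.sqrt_sq (norm_nonneg _)]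
  have hFint : Integrable fun q : ℝ × (Fin m → ℝ) => F q.1 ‖WithLp.toLp 2 q.2‖ := by
    rw [← hΨ.integrable_comp_emb Ψ.measurableEmbedding]
    exact hGint.congr (ae_of_all _ hGF)
  have h2 : ∫ x, G x = (m * volume.real (ball (0 : E m) 1)) •
      ∫ s : ℝ, ∫ ρ in Ioi (0 : ℝ), ρ ^ (m - 1) • F s ρ := by
    calc ∫ x, G x = ∫ q : ℝ × (Fin m → ℝ), F q.1 ‖WithLp.toLp 2 q.2‖ := by
          rw [← hΨ.integral_comp Ψ.measurableEmbedding]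
          exact integral_congr_ae (ae_of_all _ hGF)
      _ = ∫ s : ℝ, ∫ y : Fin m → ℝ, F s ‖WithLp.toLp 2 y‖ := integral_prod _ hFint
      _ = ∫ s : ℝ, ∫ y : E m, F s ‖y‖ := by
          congr 1; ext s
          exact (PiLp.volume_preserving_toLp (Fin m)).integral_comp
            (MeasurableEquiv.toLp 2 (Fin m → ℝ)).measurableEmbedding fun y : E m => F s ‖y‖
      _ = _ := by
          rw [← integral_smul]
          congr 1; ext s
          rw [integral_fun_norm_addHaar]
          simp [← smul_smul]
  -- polar coordinates in the plane
  have h3 : ∫ s : ℝ, ∫ ρ in Ioi (0 : ℝ), ρ ^ (m - 1) • F s ρ =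
      A • ∫ t in (0 : ℝ)..Real.pi, Real.sin t ^ (m - 1) • g (Real.cos t) := by
    set H : ℝ × ℝ → ℂ := (univ ×ˢ Ioi (0 : ℝ)).indicator fun p => p.2 ^ (m - 1) • F p.1 p.2 with hH
    have hmeasF : Measurable fun p : ℝ × ℝ => g (p.1 / Real.sqrt (p.1 ^ 2 + p.2 ^ 2)) :=
      hg.measurable.comp (Measurable.div (by fun_prop) (by fun_prop))
    have hHint : Integrable (fun p : ℝ × ℝ => p.2 ^ (m - 1) • F p.1 p.2)
        (volume.prod (volume.restrict (Ioi 0))) := by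
      have a1 : Integrable fun s : ℝ => Real.exp (-s ^ 2) := by
        simpa using integrable_exp_neg_mul_sq (b := 1) one_pos
      have a2 := a1.mul_prod (integrableOn_pow_mul_exp_neg_sq (m - 1))
      refine (a2.smul_bdd (f := fun p : ℝ × ℝ => g (p.1 / Real.sqrt (p.1 ^ 2 + p.2 ^ 2))) C
        hmeasF.aestronglyMeasurable (ae_of_all _ fun p => hC _)).congr (ae_of_all _ fun p => ?_)
      simp only [hF, smul_smul, Pi.smul_apply', neg_add, Real.exp_add]
      congr 1
      ring
    have e1 : ∫ s : ℝ, ∫ ρ in Ioi (0 : ℝ), ρ ^ (m - 1) • F s ρ = ∫ p, H p := by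
      rw [← integral_prod _ hHint, hH, integral_indicator (MeasurableSet.univ.prod measurableSet_Ioi),
        Measure.volume_eq_prod, ← Measure.prod_restrict, Measure.restrict_univ]
    have e2 : ∫ p in polarCoord.target, p.1 • H (polarCoord.symm p) =
        ∫ p in Ioi (0 : ℝ) ×ˢ Ioo 0 Real.pi, (p.1 ^ m * Real.exp (-p.1 ^ 2)) •
          (Real.sin p.2 ^ (m - 1) • g (Real.cos p.2)) := by
      rw [← integral_indicator polarCoord.open_target.measurableSet,
        ← integral_indicator (measurableSet_Ioi.prod measurableSet_Ioo)]
      congr 1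
      ext ⟨r, t⟩
      by_cases hr : 0 < r
      swap
      · rw [indicator_of_notMem, indicator_of_notMem]
        · exact fun h => hr h.1
        · exact fun h => hr h.1
      by_cases ht : t ∈ Ioo 0 Real.pi
      · have hs := Real.sin_pos_of_mem_Ioo ht
        rw [indicator_of_mem, indicator_of_mem]
        · change r • H (r * Real.cos t, r * Real.sin t) = _
          rw [hH, indicator_of_mem (show ((r * Real.cos t, r * Real.sin t) : ℝ × ℝ) ∈
            (univ : Set ℝ) ×ˢ Ioi (0 : ℝ) from ⟨mem_univ _, mul_pos hr hs⟩)]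
          have a1 : (r * Real.cos t) ^ 2 + (r * Real.sin t) ^ 2 = r ^ 2 := by
            linear_combination r ^ 2 * Real.sin_sq_add_cos_sq t
          simp only [hF, a1, Real.sqrt_sq hr.le, mul_div_cancel_left₀ _ hr.ne', smul_smul]
          congr 1
          obtain ⟨k, rfl⟩ := Nat.exists_eq_succ_of_ne_zero hm
          simp only [Nat.succ_eq_add_one, Nat.add_sub_cancel]
          ring
        · exact ⟨hr, ht⟩
        · exact ⟨hr, ⟨by linarith [ht.1, Real.pi_pos], ht.2⟩⟩
      -- The angle of `polarCoord` runs over (-π, π); angles in (-π, 0] have sin ≤ 0 and so lie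
      -- outside the half plane carrying H.
      · rw [indicator_of_notMem (s := Ioi (0 : ℝ) ×ˢ Ioo 0 Real.pi) (fun h => ht h.2)]
        by_cases ht2 : (r, t) ∈ polarCoord.target
        · rw [indicator_of_mem ht2]
          change r • H (r * Real.cos t, r * Real.sin t) = _
          have ht3 : t ∈ Ioo (-Real.pi) Real.pi := ht2.2
          have : Real.sin t ≤ 0 := by
            refine Real.sin_nonpos_of_nonpos_of_neg_pi_le ?_ ht3.1.le
            by_contra! h
            exact ht ⟨h, ht3.2⟩
          rw [hH, indicator_of_notMem, smul_zero]
          rintro ⟨-, h⟩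
          have h' : 0 < r * Real.sin t := h
          nlinarith
        · rw [indicator_of_notMem ht2]
    rw [e1, ← integral_comp_polarCoord_symm, e2, Measure.volume_eq_prod, ← Measure.prod_restrict,
      integral_prod_smul (fun r : ℝ => r ^ m * Real.exp (-r ^ 2))
        (fun t => Real.sin t ^ (m - 1) • g (Real.cos t)), intervalIntegral.integral_of_le Real.pi_pos.le,
      integral_Ioc_eq_integral_Ioo]
  rw [h3, smul_comm, h1] at h2
  exact smul_right_injective ℂ hApos.ne' h2

end Zonal

end SphericalMeans

namespace SphericalMeans

/-! ### The Newtonian potential and its Laplacian -/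

section Newton

open scoped Convolution

variable {𝕜 : Type*} [RCLike 𝕜] {n : ℕ}

/-- The Newtonian potential `∫ |x - y|^{2-n} f(y) dy`, up to normalization. -/
noncomputable def newtonPotential (f : E n → 𝕜) (x : E n) : 𝕜 :=
  ∫ t, (‖t‖ ^ (n - 2))⁻¹ • f (x - t)

/-- In polar coordinates r^{n-1} · r^{2-n} = r is integrable near 0. -/
theorem locallyIntegrable_newton (hn : 3 ≤ n) :
    LocallyIntegrable (fun t : E n => (‖t‖ ^ (n - 2))⁻¹) := by
  have : Nontrivial (E n) := by
    have : Nonempty (Fin n) := ⟨⟨0, by omega⟩⟩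
    infer_instance
  intro x
  refine ⟨ball 0 (‖x‖ + 1), isOpen_ball.mem_nhds (by simp), ?_⟩
  rw [integrableOn_fun_norm_addHaar volume (f := fun r => (r ^ (n - 2))⁻¹)]
  have : IntegrableOn (fun r : ℝ => r) (Ioo 0 (‖x‖ + 1)) :=
    (continuous_id.integrableOn_Icc).mono_set Ioo_subset_Icc_self
  refine this.congr_fun (fun r hr => ?_) measurableSet_Ioo
  have h0 : r ≠ 0 := hr.1.ne'
  obtain ⟨m, rfl⟩ := Nat.exists_eq_add_of_le hn
  simp only [finrank_euclideanSpace, Fintype.card_fin, smul_eq_mul]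
  rw [show 3 + m - 1 = m + 2 by omega, show 3 + m - 2 = m + 1 by omega]
  field_simp
  ring

variable {f : E n → 𝕜} {k : E n → ℝ}

theorem integrable_smul_sub (hk : LocallyIntegrable k) (hf : Continuous f)
    (hfc : HasCompactSupport f) (x : E n) : Integrable fun t => k t • f (x - t) :=
  hfc.convolutionExists_right (ContinuousLinearMap.lsmul ℝ ℝ) hk hf x

theorem contDiff_integral_smul_sub (hk : LocallyIntegrable k) (hf : ContDiff ℝ ∞ f)
    (hfc : HasCompactSupport f) : ContDiff ℝ ∞ fun x => ∫ t, k t • f (x - t) :=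
  hfc.contDiff_convolution_right (ContinuousLinearMap.lsmul ℝ ℝ) hk hf

theorem fderiv_integral_smul_sub (hk : LocallyIntegrable k) (hf : ContDiff ℝ ∞ f)
    (hfc : HasCompactSupport f) (x v : E n) :
    fderiv ℝ (fun x => ∫ t, k t • f (x - t)) x v = ∫ t, k t • fderiv ℝ f (x - t) v := by
  have h1 := hfc.hasFDerivAt_convolution_right (ContinuousLinearMap.lsmul ℝ ℝ) (μ := volume) hk
    (hf.of_le (by exact_mod_cast le_top)) x
  have h2 := (hfc.fderiv (𝕜 := ℝ)).convolutionExists_right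
    ((ContinuousLinearMap.lsmul ℝ ℝ).precompR (E n) :
      ℝ →L[ℝ] (E n →L[ℝ] 𝕜) →L[ℝ] (E n →L[ℝ] 𝕜)) hk (hf.continuous_fderiv (by simp)) x
  have h3 : fderiv ℝ (fun x => ∫ t, k t • f (x - t)) x = _ := h1.fderiv
  rw [h3]
  exact ContinuousLinearMap.integral_apply h2 v

theorem contDiff_fderiv_apply {F : Type*} [NormedAddCommGroup F] [NormedSpace ℝ F] {f : E n → F}
    (hf : ContDiff ℝ ∞ f) (v : E n) : ContDiff ℝ ∞ fun x => fderiv ℝ f x v :=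
  (hf.fderiv_right (m := ∞) (by simp)).clm_apply contDiff_const

theorem hasCompactSupport_fderiv_apply (hfc : HasCompactSupport f) (v : E n) :
    HasCompactSupport fun x => fderiv ℝ f x v :=
  (hfc.fderiv (𝕜 := ℝ)).comp_left (g := fun L : E n →L[ℝ] 𝕜 => L v) (by simp)

theorem laplacian_eq_sum {F : Type*} [NormedAddCommGroup F] [NormedSpace ℝ F] {f : E n → F}
    (hf : ContDiff ℝ ∞ f) (x : E n) :
    Laplacian.laplacian f x = ∑ i, fderiv ℝ (fun y => fderiv ℝ f y (EuclideanSpace.basisFun (Fin n) ℝ i)) x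
      (EuclideanSpace.basisFun (Fin n) ℝ i) := by
  rw [InnerProductSpace.laplacian_eq_iteratedFDeriv_orthonormalBasis f
    (EuclideanSpace.basisFun (Fin n) ℝ)]
  refine Finset.sum_congr rfl fun i _ => ?_
  rw [iteratedFDeriv_two_apply]
  have hd : DifferentiableAt ℝ (fderiv ℝ f) x :=
    (hf.fderiv_right (m := ∞) (by simp)).differentiable (by simp) x
  rw [fderiv_clm_apply hd (differentiableAt_const _)]
  simp

/-- The kernel is only locally integrable, so all derivatives of the convolution fall on f. -/
theorem laplacian_integral_smul_sub (hk : LocallyIntegrable k) (hf : ContDiff ℝ ∞ f)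
    (hfc : HasCompactSupport f) (x : E n) :
    Laplacian.laplacian (fun x => ∫ t, k t • f (x - t)) x =
      ∫ t, k t • Laplacian.laplacian f (x - t) := by
  rw [laplacian_eq_sum (contDiff_integral_smul_sub hk hf hfc)]
  simp_rw [fun y v => fderiv_integral_smul_sub hk hf hfc y v, laplacian_eq_sum hf, Finset.smul_sum]
  rw [integral_finsetSum]
  · refine Finset.sum_congr rfl fun i _ => ?_
    exact fderiv_integral_smul_sub hk (contDiff_fderiv_apply hf _)
      (hasCompactSupport_fderiv_apply hfc _) x _
  · intro i _
    exact integrable_smul_sub hk (contDiff_fderiv_apply (contDiff_fderiv_apply hf _) _).continuous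
      (hasCompactSupport_fderiv_apply (hasCompactSupport_fderiv_apply hfc _) _) x

theorem integral_smul_fderiv_sub (hk : ContDiff ℝ ∞ k) (hf : ContDiff ℝ ∞ f)
    (hfc : HasCompactSupport f) (x v : E n) :
    ∫ t, k t • fderiv ℝ f (x - t) v = ∫ t, fderiv ℝ k t v • f (x - t) := by
  have hF : ∀ t, fderiv ℝ (fun t => f (x - t)) t v = -fderiv ℝ f (x - t) v := by
    intro t
    have h1 := ((hf.differentiable (by simp) (x - t)).hasFDerivAt.comp t
      ((hasFDerivAt_id t).const_sub x)).fderiv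
    have h2 : fderiv ℝ (fun t => f (x - t)) t = _ := h1
    rw [h2]
    simp
  have hkc : LocallyIntegrable k := hk.continuous.locallyIntegrable
  have hkc' : LocallyIntegrable fun t => fderiv ℝ k t v :=
    (contDiff_fderiv_apply hk v).continuous.locallyIntegrable
  have := integral_bilinear_fderiv_right_eq_neg_left_of_integrable (μ := (volume : Measure (E n)))
    (f := k) (g := fun t => f (x - t)) (v := v) (B := ContinuousLinearMap.lsmul ℝ ℝ)
    (integrable_smul_sub hkc' hf.continuous hfc x) ?_ (integrable_smul_sub hkc hf.continuous hfc x)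
    (fun t _ => hk.differentiable (by simp) t) (fun t _ => ?_)
  · simp only [hF, ContinuousLinearMap.lsmul_apply, smul_neg, integral_neg, neg_inj] at this
    exact this
  · simp only [hF, ContinuousLinearMap.lsmul_apply, smul_neg]
    exact (integrable_smul_sub hkc (contDiff_fderiv_apply hf v).continuous
      (hasCompactSupport_fderiv_apply hfc v) x).neg
  · exact (hf.comp (contDiff_const.sub contDiff_id)).differentiable (by simp) t

theorem integral_smul_laplacian_sub (hk : ContDiff ℝ ∞ k) (hf : ContDiff ℝ ∞ f)
    (hfc : HasCompactSupport f) (x : E n) :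
    ∫ t, k t • Laplacian.laplacian f (x - t) = ∫ t, Laplacian.laplacian k t • f (x - t) := by
  simp_rw [laplacian_eq_sum hf, laplacian_eq_sum hk, Finset.smul_sum, Finset.sum_smul]
  rw [integral_finsetSum, integral_finsetSum]
  · refine Finset.sum_congr rfl fun i _ => ?_
    rw [integral_smul_fderiv_sub hk (contDiff_fderiv_apply hf _)
      (hasCompactSupport_fderiv_apply hfc _), integral_smul_fderiv_sub (contDiff_fderiv_apply hk _) hf hfc]
  · intro i _
    exact integrable_smul_sub (contDiff_fderiv_apply (contDiff_fderiv_apply hk _) _).continuous.locallyIntegrable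
      hf.continuous hfc x
  · intro i _
    exact integrable_smul_sub hk.continuous.locallyIntegrable
      (contDiff_fderiv_apply (contDiff_fderiv_apply hf _) _).continuous
      (hasCompactSupport_fderiv_apply (hasCompactSupport_fderiv_apply hfc _) _) x

/-- The regularized Newtonian kernel `(|t|² + δ²)^{(2-n)/2}`. -/
noncomputable def newtonReg (n : ℕ) (δ : ℝ) (t : E n) : ℝ :=
  (‖t‖ ^ 2 + δ ^ 2) ^ ((2 - (n : ℝ)) / 2)

theorem contDiff_rpow_norm_sq_add {δ : ℝ} (hδ : 0 < δ) (a : ℝ) :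
    ContDiff ℝ ∞ fun t : E n => (‖t‖ ^ 2 + δ ^ 2) ^ a :=
  ContDiff.rpow_const_of_ne ((contDiff_norm_sq ℝ).add contDiff_const) fun t => by positivity

theorem fderiv_rpow_norm_sq_add {δ : ℝ} (hδ : 0 < δ) (a : ℝ) (t v : E n) :
    fderiv ℝ (fun t : E n => (‖t‖ ^ 2 + δ ^ 2) ^ a) t v =
      (2 * a * (‖t‖ ^ 2 + δ ^ 2) ^ (a - 1)) * inner ℝ t v := by
  have h1 : HasFDerivAt (fun t : E n => ‖t‖ ^ 2 + δ ^ 2) (2 • innerSL ℝ t) t :=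
    (hasStrictFDerivAt_norm_sq t).hasFDerivAt.add_const _
  have h2 := h1.rpow_const (p := a) (Or.inl (by positivity))
  rw [h2.fderiv]
  simp
  ring

theorem laplacian_newtonReg {δ : ℝ} (hδ : 0 < δ) (t : E n) :
    Laplacian.laplacian (newtonReg n δ) t =
      -(n * (n - 2) * δ ^ 2 * (‖t‖ ^ 2 + δ ^ 2) ^ (-((n : ℝ) + 2) / 2)) := by
  set a : ℝ := (2 - (n : ℝ)) / 2 with ha
  have hpos : 0 < ‖t‖ ^ 2 + δ ^ 2 := by positivity
  rw [laplacian_eq_sum (show ContDiff ℝ ∞ (newtonReg n δ) from contDiff_rpow_norm_sq_add hδ _)]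
  have h1 : ∀ i : Fin n, fderiv ℝ (fun y => fderiv ℝ (newtonReg n δ) y
      (EuclideanSpace.basisFun (Fin n) ℝ i)) t (EuclideanSpace.basisFun (Fin n) ℝ i) =
      2 * a * (‖t‖ ^ 2 + δ ^ 2) ^ (a - 1) +
        4 * a * (a - 1) * (‖t‖ ^ 2 + δ ^ 2) ^ (a - 2) * (t i) ^ 2 := by
    intro i
    have e1 : (fun y => fderiv ℝ (newtonReg n δ) y (EuclideanSpace.basisFun (Fin n) ℝ i)) =
        fun y => (2 * a) • ((‖y‖ ^ 2 + δ ^ 2) ^ (a - 1) *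
          inner ℝ (EuclideanSpace.basisFun (Fin n) ℝ i) y) := by
      ext y
      have := fderiv_rpow_norm_sq_add hδ a y (EuclideanSpace.basisFun (Fin n) ℝ i)
      rw [real_inner_comm] at this
      simp only [smul_eq_mul, ← mul_assoc]
      exact this
    have d1 : DifferentiableAt ℝ (fun y : E n => (‖y‖ ^ 2 + δ ^ 2) ^ (a - 1)) t :=
      (contDiff_rpow_norm_sq_add hδ _).differentiable (by simp) t
    have d2 : HasFDerivAt (fun y : E n => inner ℝ (EuclideanSpace.basisFun (Fin n) ℝ i) y)
        (innerSL ℝ (EuclideanSpace.basisFun (Fin n) ℝ i)) t :=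
      (innerSL ℝ (EuclideanSpace.basisFun (Fin n) ℝ i)).hasFDerivAt
    have e2 := ((d1.hasFDerivAt.mul d2).const_smul (2 * a)).fderiv
    rw [e1]
    refine (congrArg (fun L : E n →L[ℝ] ℝ => L (EuclideanSpace.basisFun (Fin n) ℝ i)) e2).trans ?_
    simp only [smul_apply, add_apply, innerSL_apply_apply,
      fderiv_rpow_norm_sq_add hδ, smul_eq_mul]
    rw [show a - 1 - 1 = a - 2 by ring]
    have i1 : inner ℝ t (EuclideanSpace.basisFun (Fin n) ℝ i) = t i := by
      simp [EuclideanSpace.inner_single_right]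
    have i2 : inner ℝ (EuclideanSpace.basisFun (Fin n) ℝ i) t = t i := by
      rw [real_inner_comm, i1]
    have i3 : inner ℝ (EuclideanSpace.basisFun (Fin n) ℝ i)
        (EuclideanSpace.basisFun (Fin n) ℝ i) = (1 : ℝ) := by
      simp
    rw [i1, i2, i3]
    ring
  simp_rw [h1]
  rw [Finset.sum_add_distrib, Finset.sum_const, ← Finset.mul_sum, Finset.card_univ,
    Fintype.card_fin, nsmul_eq_mul]
  have h2 : ∑ i, (t i) ^ 2 = ‖t‖ ^ 2 := by
    rw [EuclideanSpace.norm_sq_eq]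
    simp
  have h3 : (‖t‖ ^ 2 + δ ^ 2) ^ (a - 1) = (‖t‖ ^ 2 + δ ^ 2) ^ (a - 2) * (‖t‖ ^ 2 + δ ^ 2) := by
    rw [← Real.rpow_add_one hpos.ne']
    congr 1; ring
  rw [h2, h3, show -((n : ℝ) + 2) / 2 = a - 2 by rw [ha]; ring]
  have h4 : (n : ℝ) = 2 - 2 * a := by rw [ha]; ring
  rw [h4]
  ring

/-- The radial integrand y^{n-1}(1 + y²)^{-(n+2)/2} has the antiderivative y^n (1 + y²)^{-n/2} / n,
which increases from 0 to 1/n. -/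
theorem integral_rpow_one_add_norm_sq (hn : n ≠ 0) :
    ∫ w : E n, (1 + ‖w‖ ^ 2) ^ (-((n : ℝ) + 2) / 2) = (unitSphereMeasure n).real univ / n := by
  have : Nontrivial (E n) := by
    have : Nonempty (Fin n) := ⟨⟨0, Nat.pos_of_ne_zero hn⟩⟩
    infer_instance
  have hn' : (n : ℝ) ≠ 0 := by exact_mod_cast hn
  have hder : ∀ y ∈ Ici (0 : ℝ), HasDerivAt
      (fun y : ℝ => (n : ℝ)⁻¹ * (y ^ n * (1 + y ^ 2) ^ (-(n : ℝ) / 2)))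
      (y ^ (n - 1) * (1 + y ^ 2) ^ (-((n : ℝ) + 2) / 2)) y := by
    intro y _
    have hpos : 0 < 1 + y ^ 2 := by positivity
    have h1 : HasDerivAt (fun y : ℝ => 1 + y ^ 2) (2 * y) y := by
      simpa using (hasDerivAt_pow 2 y).const_add 1
    have h2 := ((hasDerivAt_pow n y).mul (h1.rpow_const (p := -(n : ℝ) / 2)
      (Or.inl hpos.ne'))).const_mul (n : ℝ)⁻¹
    refine h2.congr_deriv ?_
    have h3 : (1 + y ^ 2) ^ (-(n : ℝ) / 2) = (1 + y ^ 2) ^ (-((n : ℝ) + 2) / 2) * (1 + y ^ 2) := by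
      rw [← Real.rpow_add_one hpos.ne']
      congr 1; ring
    rw [h3, show -(n : ℝ) / 2 - 1 = -((n : ℝ) + 2) / 2 by ring]
    obtain ⟨m, rfl⟩ := Nat.exists_eq_succ_of_ne_zero hn
    simp only [Nat.succ_eq_add_one, Nat.add_sub_cancel, pow_succ y m]
    field_simp
    ring
  have hlim : Tendsto (fun y : ℝ => (n : ℝ)⁻¹ * (y ^ n * (1 + y ^ 2) ^ (-(n : ℝ) / 2))) atTop
      (𝓝 ((n : ℝ)⁻¹ * 1)) := by
    refine Tendsto.const_mul _ ?_
    have h0 : Tendsto (fun y : ℝ => ((y⁻¹) ^ 2 + 1) ^ (-(n : ℝ) / 2)) atTop (𝓝 1) := by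
      have : ContinuousAt (fun s : ℝ => (s ^ 2 + 1) ^ (-(n : ℝ) / 2)) 0 :=
        ContinuousAt.rpow_const (by fun_prop) (Or.inl (by simp))
      simpa [Function.comp_def] using this.tendsto.comp tendsto_inv_atTop_zero
    refine h0.congr' ?_
    filter_upwards [eventually_gt_atTop 0] with y hy
    rw [show (y⁻¹) ^ 2 + 1 = (1 + y ^ 2) * (y ^ 2)⁻¹ by field_simp,
      Real.mul_rpow (by positivity) (by positivity), mul_comm, Real.inv_rpow (by positivity),
      ← Real.rpow_neg (by positivity)]
    congr 1
    rw [← Real.rpow_natCast y 2, ← Real.rpow_mul hy.le, ← Real.rpow_natCast y n]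
    congr 1
    push_cast; ring
  rw [integral_fun_norm_addHaar volume fun r : ℝ => (1 + r ^ 2) ^ (-((n : ℝ) + 2) / 2)]
  simp only [finrank_euclideanSpace, Fintype.card_fin, smul_eq_mul]
  rw [integral_Ioi_of_hasDerivAt_of_nonneg' hder
    (fun y (hy : 0 < y) => by positivity) hlim]
  simp only [unitSphereMeasure, Measure.toSphere_real_apply_univ, finrank_euclideanSpace,
    Fintype.card_fin, nsmul_eq_mul]
  simp [hn]
  field_simp

theorem newtonReg_eq (hn : 2 ≤ n) (δ : ℝ) (t : E n) :
    newtonReg n δ t = (Real.sqrt (‖t‖ ^ 2 + δ ^ 2) ^ (n - 2))⁻¹ := by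
  have h0 : 0 ≤ ‖t‖ ^ 2 + δ ^ 2 := by positivity
  rw [newtonReg]
  generalize ‖t‖ ^ 2 + δ ^ 2 = q at *
  rw [Real.sqrt_eq_rpow, ← Real.rpow_natCast, ← Real.rpow_mul h0, ← Real.rpow_neg h0,
    Nat.cast_sub hn]
  congr 1
  push_cast; ring

/-- The regularized kernel is dominated by the singular one, which is integrable against g. -/
theorem tendsto_integral_newtonReg (hn : 3 ≤ n) {g : E n → 𝕜} (hg : Continuous g)
    (hgc : HasCompactSupport g) (x : E n) :
    Tendsto (fun δ : ℝ => ∫ t, newtonReg n δ t • g (x - t)) (𝓝[>] 0)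
      (𝓝 (∫ t, (‖t‖ ^ (n - 2))⁻¹ • g (x - t))) := by
  have : Nontrivial (E n) := by
    have : Nonempty (Fin n) := ⟨⟨0, by omega⟩⟩
    infer_instance
  have h0 : ∀ᵐ t : E n, t ≠ 0 := Measure.ae_ne volume 0
  have hint := (integrable_smul_sub (locallyIntegrable_newton hn) hg hgc x).norm
  refine tendsto_integral_filter_of_dominated_convergence _ ?_ ?_ hint ?_
  · filter_upwards [self_mem_nhdsWithin] with δ hδ
    exact ((contDiff_rpow_norm_sq_add hδ _).continuous.smul
      (hg.comp (continuous_const.sub continuous_id))).aestronglyMeasurable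
  · filter_upwards with δ
    filter_upwards [h0] with t ht
    rw [norm_smul, norm_smul, newtonReg_eq (by omega)]
    have h2 : 0 < ‖t‖ := norm_pos_iff.2 ht
    have h3 : ‖t‖ ≤ Real.sqrt (‖t‖ ^ 2 + δ ^ 2) :=
      Real.le_sqrt_of_sq_le (by nlinarith [sq_nonneg δ])
    rw [Real.norm_of_nonneg (by positivity), Real.norm_of_nonneg (by positivity)]
    gcongr
  · filter_upwards [h0] with t ht
    refine Tendsto.smul_const ?_ _
    simp_rw [newtonReg_eq (show 2 ≤ n by omega)]
    have h2 : 0 < ‖t‖ := norm_pos_iff.2 ht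
    have : ContinuousAt (fun δ : ℝ => ((Real.sqrt (‖t‖ ^ 2 + δ ^ 2)) ^ (n - 2))⁻¹) 0 := by
      refine ContinuousAt.inv₀ (by fun_prop) ?_
      simp only [ne_eq, OfNat.ofNat_ne_zero, not_false_eq_true, zero_pow, add_zero,
        Real.sqrt_sq h2.le]
      positivity
    have h3 := this.tendsto
    simp only [ne_eq, OfNat.ofNat_ne_zero, not_false_eq_true, zero_pow, add_zero,
        Real.sqrt_sq h2.le] at h3
    exact h3.mono_left nhdsWithin_le_nhds

/-- The Laplacian of the regularized Newtonian kernel is an approximate identity. -/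
theorem integral_newtonReg_laplacian (hf : ContDiff ℝ ∞ f) (hfc : HasCompactSupport f)
    (x : E n) {δ : ℝ} (hδ : 0 < δ) :
    ∫ t, newtonReg n δ t • Laplacian.laplacian f (x - t) =
      -((n : ℝ) * (n - 2)) •
        ∫ w : E n, ((1 + ‖w‖ ^ 2) ^ (-((n : ℝ) + 2) / 2)) • f (x - δ • w) := by
  have hreg : ContDiff ℝ ∞ (newtonReg n δ) := contDiff_rpow_norm_sq_add hδ _
  rw [integral_smul_laplacian_sub hreg hf hfc]
  have h2 := Measure.integral_comp_smul (volume : Measure (E n))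
    (fun t => Laplacian.laplacian (newtonReg n δ) t • f (x - t)) δ
  rw [finrank_euclideanSpace, Fintype.card_fin, abs_of_pos (by positivity), eq_comm,
    inv_smul_eq_iff₀ (by positivity)] at h2
  rw [h2, ← integral_smul, ← integral_smul]
  refine integral_congr_ae (ae_of_all _ fun w => ?_)
  simp only [smul_smul]
  congr 1
  rw [laplacian_newtonReg hδ, norm_smul, Real.norm_of_nonneg hδ.le,
    show (δ * ‖w‖) ^ 2 + δ ^ 2 = δ ^ 2 * (1 + ‖w‖ ^ 2) by ring,
    Real.mul_rpow (by positivity) (by positivity)]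
  -- The Jacobian δ^n of t = δw and the factor δ² cancel the scaling δ^{-(n+2)} of the kernel.
  have h3 : δ ^ n * (δ ^ 2 * (δ ^ 2) ^ (-((n : ℝ) + 2) / 2)) = 1 := by
    rw [← Real.rpow_natCast δ 2, ← Real.rpow_mul hδ.le, ← Real.rpow_natCast δ n,
      ← Real.rpow_add hδ, ← Real.rpow_add hδ,
      show (n : ℝ) + (((2 : ℕ) : ℝ) + ((2 : ℕ) : ℝ) * (-((n : ℝ) + 2) / 2)) = 0 by push_cast; ring,
      Real.rpow_zero]
  linear_combination (-((n : ℝ) * (n - 2)) * (1 + ‖w‖ ^ 2) ^ (-((n : ℝ) + 2) / 2)) * h3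

theorem tendsto_integral_smul_sub_smul {J : E n → ℝ} (hJ : Integrable J) (hf : Continuous f)
    (hfc : HasCompactSupport f) (x : E n) :
    Tendsto (fun δ : ℝ => ∫ w : E n, J w • f (x - δ • w)) (𝓝[>] 0) (𝓝 ((∫ w, J w) • f x)) := by
  obtain ⟨C, hC⟩ := hfc.exists_bound_of_continuous hf
  rw [← integral_smul_const]
  refine tendsto_integral_filter_of_dominated_convergence (fun w => ‖J w‖ * C) ?_ ?_ ?_ ?_
  · filter_upwards with δ
    have : Continuous fun w : E n => f (x - δ • w) := hf.comp (by fun_prop)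
    exact hJ.aestronglyMeasurable.smul this.aestronglyMeasurable
  · filter_upwards with δ
    refine ae_of_all _ fun w => ?_
    rw [norm_smul]
    gcongr
    exact hC _
  · exact hJ.norm.mul_const C
  · refine ae_of_all _ fun w => Tendsto.const_smul ?_ _
    have : Continuous fun δ : ℝ => f (x - δ • w) := hf.comp (by fun_prop)
    have h3 := this.tendsto 0
    simp only [zero_smul, sub_zero] at h3
    exact h3.mono_left nhdsWithin_le_nhds

theorem continuous_laplacian (hf : ContDiff ℝ ∞ f) : Continuous (Laplacian.laplacian f) := by
  rw [show Laplacian.laplacian f = _ from funext fun x => laplacian_eq_sum hf x]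
  exact continuous_finsetSum _ fun i _ =>
    (contDiff_fderiv_apply (contDiff_fderiv_apply hf _) _).continuous

theorem hasCompactSupport_laplacian (hfc : HasCompactSupport f) :
    HasCompactSupport (Laplacian.laplacian f) := by
  rw [InnerProductSpace.laplacian_eq_iteratedFDeriv_orthonormalBasis f
    (EuclideanSpace.basisFun (Fin n) ℝ)]
  refine (hfc.iteratedFDeriv (𝕜 := ℝ) 2).mono' ?_
  intro y hy
  refine subset_tsupport _ ?_
  contrapose! hy
  simp only [Function.mem_support, not_not] at hy ⊢
  simp [hy]

theorem contDiff_newtonPotential (hn : 3 ≤ n) (hf : ContDiff ℝ ∞ f) (hfc : HasCompactSupport f) :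
    ContDiff ℝ ∞ (newtonPotential f) :=
  contDiff_integral_smul_sub (locallyIntegrable_newton hn) hf hfc

/-- Put Δ on f, regularize the kernel, and move Δ onto the smooth kernel. There it becomes an
approximate identity of mass -n(n-2) · σ/n, where σ is the area of the unit sphere. -/
theorem laplacian_newtonPotential (hn : 3 ≤ n) (hf : ContDiff ℝ ∞ f) (hfc : HasCompactSupport f)
    (x : E n) : Laplacian.laplacian (newtonPotential f) x =
      -(((n : ℝ) - 2) * (unitSphereMeasure n).real univ) • f x := by
  have h1 : Laplacian.laplacian (newtonPotential f) x =
      ∫ t, (‖t‖ ^ (n - 2))⁻¹ • Laplacian.laplacian f (x - t) :=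
    laplacian_integral_smul_sub (locallyIntegrable_newton hn) hf hfc x
  have hJ : Integrable fun w : E n => (1 + ‖w‖ ^ 2) ^ (-((n : ℝ) + 2) / 2) :=
    integrable_rpow_neg_one_add_norm_sq (by simp)
  have hA := tendsto_integral_newtonReg hn (continuous_laplacian hf)
    (hasCompactSupport_laplacian hfc) x
  have hC := (tendsto_integral_smul_sub_smul hJ hf.continuous hfc x).const_smul
    (-((n : ℝ) * (n - 2)))
  have hD := tendsto_nhds_unique hA (hC.congr' (by
    filter_upwards [self_mem_nhdsWithin] with δ hδ
    exact (integral_newtonReg_laplacian hf hfc x hδ).symm))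
  rw [h1, hD, integral_rpow_one_add_norm_sq (by omega), smul_smul]
  congr 1
  have : (n : ℝ) ≠ 0 := by
    have : n ≠ 0 := by omega
    exact_mod_cast this
  field_simp

end Newton

end SphericalMeans

namespace SphericalMeans

variable {𝕜 : Type*} [RCLike 𝕜] {n : ℕ}

/-! ### Moments of the filtered means against regularized kernels -/

section Kernels

variable (T : ℂ →L[ℝ] ℝ) (u₀ : ℝ) {ε : ℝ}

theorem im_ofReal_add_pos (hε : 0 < ε) (v : ℝ) : 0 < ((v : ℂ) + ε * Complex.I).im := by simpa

theorem ofReal_add_ne_zero (hε : 0 < ε) (v : ℝ) : (v : ℂ) + ε * Complex.I ≠ 0 := by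
  intro h
  have := im_ofReal_add_pos hε v
  rw [h] at this
  simp at this

theorem hasDerivAt_ofReal_sub_add (u : ℝ) :
    HasDerivAt (fun u : ℝ => (((u - u₀ : ℝ) : ℂ) + ε * Complex.I)) 1 u := by
  have := ((hasDerivAt_id u).sub_const u₀).ofReal_comp.add_const (ε * Complex.I)
  simpa using this

theorem hasDerivAt_inv_pow_kernel (hε : 0 < ε) (j : ℕ) (u : ℝ) :
    HasDerivAt (fun u : ℝ => T ((((u - u₀ : ℝ) : ℂ) + ε * Complex.I)⁻¹ ^ (j + 1)))
      (-(j + 1) * T ((((u - u₀ : ℝ) : ℂ) + ε * Complex.I)⁻¹ ^ (j + 2))) u := by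
  have hne := ofReal_add_ne_zero hε (u - u₀)
  have h1 := ((hasDerivAt_ofReal_sub_add u₀ (ε := ε) u).inv hne).pow (j + 1)
  have h2 := T.hasFDerivAt.comp_hasDerivAt u h1
  refine h2.congr_deriv ?_
  rw [← smul_eq_mul (-((j : ℝ) + 1)), ← map_smul]
  congr 1
  simp only [Complex.real_smul, Nat.add_sub_cancel, Pi.inv_apply]
  push_cast
  have h3 : -(1 : ℂ) / (((u : ℂ) - u₀) + ε * Complex.I) ^ 2 =
      -(((u : ℂ) - u₀) + ε * Complex.I)⁻¹ ^ 2 := by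
    rw [inv_pow, neg_div, one_div]
  rw [h3]
  ring

theorem hasDerivAt_log_kernel (hε : 0 < ε) (u : ℝ) :
    HasDerivAt (fun u : ℝ => T (Complex.log (((u - u₀ : ℝ) : ℂ) + ε * Complex.I)))
      (T ((((u - u₀ : ℝ) : ℂ) + ε * Complex.I)⁻¹ ^ 1)) u := by
  have hs : ((u - u₀ : ℝ) : ℂ) + ε * Complex.I ∈ Complex.slitPlane :=
    Complex.mem_slitPlane_iff.2 (Or.inr (im_ofReal_add_pos hε _).ne')
  have h1 := (Complex.hasDerivAt_log hs).comp u (hasDerivAt_ofReal_sub_add u₀ (ε := ε) u)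
  have h2 := T.hasFDerivAt.comp_hasDerivAt u h1
  refine h2.congr_deriv ?_
  simp

theorem continuous_inv_pow_kernel (hε : 0 < ε) (j : ℕ) :
    Continuous fun v : ℝ => T (((v : ℂ) + ε * Complex.I)⁻¹ ^ j) :=
  T.continuous.comp ((Continuous.inv₀ (by fun_prop) (ofReal_add_ne_zero hε)).pow j)

variable {f : E n → 𝕜} {R ρ : ℝ} {ξ : E n}

/-- Each integration by parts raises the exponent by one. Its minus sign cancels the one from
differentiating the power, and the exponents accumulate to (j+k)!/j!. -/
theorem integral_inv_pow_kernel_filteredMean (hf : ContDiff ℝ ∞ f) (hR : 0 ≤ R) (hρR : ρ < R)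
    (hs : ∀ y, ρ < ‖y‖ → f y = 0) (hξ : ξ ∈ sphere (0 : E n) R) (hε : 0 < ε) (k j : ℕ) :
    (j ! : ℝ) • ∫ t in (0 : ℝ)..(2 * R),
      (t * T ((((t ^ 2 - u₀ : ℝ) : ℂ) + ε * Complex.I)⁻¹ ^ (j + 1))) • filteredMean k f ξ t =
    ((j + k)! : ℝ) • ∫ t in (0 : ℝ)..(2 * R),
      (t * T ((((t ^ 2 - u₀ : ℝ) : ℂ) + ε * Complex.I)⁻¹ ^ (j + k + 1))) • filteredMean 0 f ξ t := by
  induction k generalizing j with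
  | zero => simp
  | succ k ih =>
    have hb := (isBump_filteredMean hf hs hξ k).integral_opD (by linarith) (by linarith)
      (hasDerivAt_inv_pow_kernel T u₀ hε j) (continuous_const.mul
        ((continuous_inv_pow_kernel T hε (j + 2)).comp (continuous_id.sub continuous_const)))
    have h1 : filteredMean (k + 1) f ξ = opD (filteredMean k f ξ) := by
      simp only [filteredMean, Function.iterate_succ_apply']
    have h2 : ∀ t : ℝ, (t * (-((j : ℝ) + 1) *
        T ((((t ^ 2 - u₀ : ℝ) : ℂ) + ε * Complex.I)⁻¹ ^ (j + 2)))) • filteredMean k f ξ t =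
        (-((j : ℝ) + 1)) • ((t * T ((((t ^ 2 - u₀ : ℝ) : ℂ) + ε * Complex.I)⁻¹ ^ (j + 2))) •
          filteredMean k f ξ t) := by
      intro t
      rw [smul_smul]
      congr 1
      ring
    simp_rw [h2, intervalIntegral.integral_smul] at hb
    have h3 := ih (j + 1)
    rw [show j + 1 + k = j + (k + 1) by ring] at h3
    rw [h1, hb, ← h3, neg_smul, neg_neg, smul_smul, Nat.factorial_succ]
    push_cast
    rw [mul_comm]

/-- The moment of the filtered mean against a regularized logarithm is a volume integral. -/
theorem integral_log_kernel_filteredMean (hn : 2 ≤ n) (hf : ContDiff ℝ ∞ f)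
    (hfc : HasCompactSupport f) (hR : 0 ≤ R) (hρR : ρ < R)
    (hs : ∀ y, ρ < ‖y‖ → f y = 0) (hξ : ξ ∈ sphere (0 : E n) R) (hε : 0 < ε) (k : ℕ) :
    ∫ t in (0 : ℝ)..(2 * R), (t * T (Complex.log (((t ^ 2 - u₀ : ℝ) : ℂ) + ε * Complex.I))) •
      filteredMean (k + 1) f ξ t =
    (-((k ! : ℝ) * ((unitSphereMeasure n).real univ)⁻¹)) •
      ∫ y, T ((((‖y - ξ‖ ^ 2 - u₀ : ℝ) : ℂ) + ε * Complex.I)⁻¹ ^ (k + 1)) • f y := by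
  have hc : ∀ j, Continuous fun u : ℝ => T ((((u - u₀ : ℝ) : ℂ) + ε * Complex.I)⁻¹ ^ j) :=
    fun j => (continuous_inv_pow_kernel T hε j).comp (continuous_id.sub continuous_const)
  have hb := (isBump_filteredMean hf hs hξ k).integral_opD (by linarith) (by linarith)
    (hasDerivAt_log_kernel T u₀ hε) (hc 1)
  have h1 : filteredMean (k + 1) f ξ = opD (filteredMean k f ξ) := by
    simp only [filteredMean, Function.iterate_succ_apply']
  have h2 := integral_inv_pow_kernel_filteredMean T u₀ hf hR hρR hs hξ hε k 0
  simp only [Nat.factorial_zero, Nat.cast_one, one_smul, zero_add] at h2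
  rw [h1, hb, h2, integral_filteredMean_zero hn hf hfc hR hρR hs hξ (hc (k + 1)), smul_smul, neg_smul]

end Kernels

/-! ### Removing the regularization of the logarithm -/

section LogLimit

variable (T : ℂ →L[ℝ] ℝ)

theorem abs_log_le_add {a b c : ℝ} (ha : 0 < a) (hab : a ≤ b) (hbc : b ≤ c) :
    |Real.log b| ≤ |Real.log a| + |Real.log c| := by
  have h1 := Real.log_le_log ha hab
  have h2 := Real.log_le_log (ha.trans_le hab) hbc
  rw [abs_le]
  constructor
  · linarith [neg_abs_le (Real.log a), abs_nonneg (Real.log c)]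
  · linarith [le_abs_self (Real.log c), abs_nonneg (Real.log a)]

theorem abs_apply_log_le {v ε V : ℝ} (hv : v ≠ 0) (hV : |v| ≤ V) (hε : 0 < ε) (hε1 : ε ≤ 1) :
    |T (Complex.log ((v : ℂ) + ε * Complex.I))| ≤
      ‖T‖ * (|Real.log v| + |Real.log (V + 1)| + Real.pi) := by
  refine (T.le_opNorm _).trans ?_
  gcongr
  refine (Complex.norm_le_abs_re_add_abs_im _).trans ?_
  rw [Complex.log_re, Complex.log_im]
  have h1 : |v| ≤ ‖(v : ℂ) + ε * Complex.I‖ := by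
    have := Complex.abs_re_le_norm ((v : ℂ) + ε * Complex.I)
    simpa using this
  have h2 : ‖(v : ℂ) + ε * Complex.I‖ ≤ V + 1 := by
    refine (norm_add_le _ _).trans ?_
    simp only [Complex.norm_real, norm_mul, Complex.norm_I, mul_one, Real.norm_eq_abs,
      abs_of_pos hε]
    linarith
  have h3 := abs_log_le_add (abs_pos.2 hv) h1 h2
  rw [Real.log_abs] at h3
  linarith [Complex.abs_arg_le_pi ((v : ℂ) + ε * Complex.I)]

/-- The principal branch has argument π on the negative axis, hence is continuous there from the
upper half plane. -/
theorem tendsto_apply_log {v : ℝ} (hv : v ≠ 0) :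
    Tendsto (fun ε : ℝ => T (Complex.log ((v : ℂ) + ε * Complex.I))) (𝓝[>] 0)
      (𝓝 (T (Complex.log v))) := by
  refine (T.continuous.tendsto _).comp ?_
  have hlin : Tendsto (fun ε : ℝ => (v : ℂ) + ε * Complex.I) (𝓝[>] 0) (𝓝 (v : ℂ)) := by
    have : Continuous fun ε : ℝ => (v : ℂ) + ε * Complex.I := by fun_prop
    have h := this.tendsto 0
    simp only [Complex.ofReal_zero, zero_mul, add_zero] at h
    exact h.mono_left nhdsWithin_le_nhds
  rcases lt_or_gt_of_ne hv with h | h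
  · have h1 := Complex.continuousWithinAt_log_of_re_neg_of_im_zero (z := (v : ℂ)) (by simpa) (by simp)
    refine h1.tendsto.comp (tendsto_nhdsWithin_iff.2 ⟨hlin, ?_⟩)
    filter_upwards [self_mem_nhdsWithin] with ε (hε : 0 < ε)
    simpa using hε.le
  · have h1 : ContinuousAt Complex.log (v : ℂ) :=
      continuousAt_clog (Complex.mem_slitPlane_iff.2 (Or.inl (by simpa)))
    exact h1.tendsto.comp hlin

theorem intervalIntegrable_abs_log (a b : ℝ) :
    IntervalIntegrable (fun t => |Real.log t|) volume a b :=
  intervalIntegral.intervalIntegrable_log'.abs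

theorem abs_log_sq_sub_sq_le {r t : ℝ} :
    |Real.log (t ^ 2 - r ^ 2)| ≤ |Real.log (t - r)| + |Real.log (t + r)| := by
  by_cases h1 : t - r = 0
  · have : t ^ 2 - r ^ 2 = 0 := by linear_combination (t + r) * h1
    rw [this, h1]; simp
  by_cases h2 : t + r = 0
  · have : t ^ 2 - r ^ 2 = 0 := by linear_combination (t - r) * h2
    rw [this, h2]; simp
  rw [show t ^ 2 - r ^ 2 = (t - r) * (t + r) by ring, Real.log_mul h1 h2]
  exact abs_add_le _ _

/-- A majorant of `|log |t² - r²||` on `[0, b]` whose integral is bounded uniformly in `r`. -/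
theorem integral_abs_log_sub_add_le {r b : ℝ} (hr : 0 ≤ r) (hrb : r ≤ b) :
    ∫ t in (0 : ℝ)..b, (|Real.log (t - r)| + |Real.log (t + r)|) ≤
      2 * ∫ t in (-(2 * b))..(2 * b), |Real.log t| := by
  have h1 : IntervalIntegrable (fun t => |Real.log (t - r)|) volume 0 b := by
    have := (intervalIntegrable_abs_log (0 - r) (b - r)).comp_sub_right r
    simpa using this
  have h2 : IntervalIntegrable (fun t => |Real.log (t + r)|) volume 0 b := by
    have := (intervalIntegrable_abs_log (0 + r) (b + r)).comp_add_right r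
    simpa using this
  rw [intervalIntegral.integral_add h1 h2,
    intervalIntegral.integral_comp_sub_right (fun t => |Real.log t|),
    intervalIntegral.integral_comp_add_right (fun t => |Real.log t|)]
  have hnn : 0 ≤ᵐ[volume.restrict (Ioc (-(2 * b)) (2 * b))] fun t => |Real.log t| :=
    ae_of_all _ fun t => abs_nonneg _
  have e1 := intervalIntegral.integral_mono_interval (f := fun t => |Real.log t|) (μ := volume)
    (c := -(2 * b)) (a := 0 - r) (b := b - r) (d := 2 * b) (by linarith) (by linarith) (by linarith)
    hnn (intervalIntegrable_abs_log _ _)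
  have e2 := intervalIntegral.integral_mono_interval (f := fun t => |Real.log t|) (μ := volume)
    (c := -(2 * b)) (a := 0 + r) (b := b + r) (d := 2 * b) (by linarith) (by linarith) (by linarith)
    hnn (intervalIntegrable_abs_log _ _)
  linarith

theorem intervalIntegrable_abs_log_sub_add (r b : ℝ) :
    IntervalIntegrable (fun t => |Real.log (t - r)| + |Real.log (t + r)|) volume 0 b := by
  have h1 : IntervalIntegrable (fun t => |Real.log (t - r)|) volume 0 b := by
    have := (intervalIntegrable_abs_log (0 - r) (b - r)).comp_sub_right r
    simpa using this
  have h2 : IntervalIntegrable (fun t => |Real.log (t + r)|) volume 0 b := by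
    have := (intervalIntegrable_abs_log (0 + r) (b + r)).comp_add_right r
    simpa using this
  exact h1.add h2

/-- The majorant for the regularized logarithmic kernels. -/
noncomputable def logMajorant (T : ℂ →L[ℝ] ℝ) (b M r t : ℝ) : ℝ :=
  b * (‖T‖ * ((|Real.log (t - r)| + |Real.log (t + r)|) + (|Real.log (b ^ 2 + 1)| + Real.pi))) * M

theorem intervalIntegrable_logMajorant (b M r : ℝ) :
    IntervalIntegrable (logMajorant T b M r) volume 0 b :=
  ((((intervalIntegrable_abs_log_sub_add r b).add intervalIntegrable_const).const_mul _).const_mul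
    _).mul_const _

variable {G : ℝ → 𝕜} {b M r : ℝ}

theorem norm_log_kernel_smul_le (hr : 0 ≤ r) (hrb : r ≤ b) (hM : ∀ t, 0 ≤ t → ‖G t‖ ≤ M)
    {ε t : ℝ} (hε : 0 < ε) (hε1 : ε ≤ 1) (ht : t ∈ Ioc 0 b) (htr : t ≠ r) :
    ‖(t * T (Complex.log (((t ^ 2 - r ^ 2 : ℝ) : ℂ) + ε * Complex.I))) • G t‖ ≤
      logMajorant T b M r t := by
  have hb : 0 < b := ht.1.trans_le ht.2
  have hv : t ^ 2 - r ^ 2 ≠ 0 := by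
    rw [show t ^ 2 - r ^ 2 = (t - r) * (t + r) by ring]
    have : 0 < t + r := by linarith [ht.1]
    exact mul_ne_zero (sub_ne_zero.2 htr) this.ne'
  have hV : |t ^ 2 - r ^ 2| ≤ b ^ 2 := by
    have h1 : t ^ 2 ≤ b ^ 2 := pow_le_pow_left₀ ht.1.le ht.2 2
    have h2 : r ^ 2 ≤ b ^ 2 := pow_le_pow_left₀ hr hrb 2
    rw [abs_le]
    constructor <;> nlinarith [sq_nonneg t, sq_nonneg r]
  have h1 := abs_apply_log_le T hv hV hε hε1
  have hM0 : 0 ≤ M := (norm_nonneg _).trans (hM 0 le_rfl)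
  rw [norm_smul, norm_mul, Real.norm_of_nonneg ht.1.le, logMajorant, Real.norm_eq_abs]
  gcongr
  · exact ht.2
  · refine h1.trans (mul_le_mul_of_nonneg_left ?_ (norm_nonneg T))
    linarith [abs_log_sq_sub_sq_le (r := r) (t := t)]
  · exact hM t ht.1.le

/-- The bound depends neither on r nor on ε, so it serves as a constant majorant when the result is
integrated over ξ. -/
theorem norm_integral_log_kernel_le (hr : 0 ≤ r) (hb : 0 ≤ b) (hrb : r ≤ b)
    (hM : ∀ t, 0 ≤ t → ‖G t‖ ≤ M) {ε : ℝ} (hε : 0 < ε) (hε1 : ε ≤ 1) :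
    ‖∫ t in (0 : ℝ)..b, (t * T (Complex.log (((t ^ 2 - r ^ 2 : ℝ) : ℂ) + ε * Complex.I))) • G t‖ ≤
      b * (‖T‖ * (2 * (∫ t in (-(2 * b))..(2 * b), |Real.log t|) +
        b * (|Real.log (b ^ 2 + 1)| + Real.pi))) * M := by
  have hM0 : 0 ≤ M := (norm_nonneg _).trans (hM 0 le_rfl)
  have h1 := intervalIntegral.norm_integral_le_of_norm_le hb (μ := volume)
    (f := fun t => (t * T (Complex.log (((t ^ 2 - r ^ 2 : ℝ) : ℂ) + ε * Complex.I))) • G t)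
    (g := logMajorant T b M r) (by
      filter_upwards [Measure.ae_ne volume r] with t htr ht
      exact norm_log_kernel_smul_le T hr hrb hM hε hε1 ht htr) (intervalIntegrable_logMajorant T b M r)
  refine h1.trans ?_
  unfold logMajorant
  rw [intervalIntegral.integral_mul_const, intervalIntegral.integral_const_mul,
    intervalIntegral.integral_const_mul, intervalIntegral.integral_add
      (intervalIntegrable_abs_log_sub_add r b) intervalIntegrable_const,
    intervalIntegral.integral_const, sub_zero, smul_eq_mul]
  gcongr
  exact integral_abs_log_sub_add_le hr hrb

theorem tendsto_integral_log_kernel (hr : 0 ≤ r) (hb : 0 ≤ b) (hrb : r ≤ b)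
    (hM : ∀ t, 0 ≤ t → ‖G t‖ ≤ M) (hG : ContinuousOn G (Icc 0 b)) :
    Tendsto (fun ε : ℝ => ∫ t in (0 : ℝ)..b,
        (t * T (Complex.log (((t ^ 2 - r ^ 2 : ℝ) : ℂ) + ε * Complex.I))) • G t) (𝓝[>] 0)
      (𝓝 (∫ t in (0 : ℝ)..b, (t * T (Complex.log ((t ^ 2 - r ^ 2 : ℝ) : ℂ))) • G t)) := by
  have hev : ∀ᶠ ε : ℝ in 𝓝[>] 0, 0 < ε ∧ ε ≤ 1 := by
    filter_upwards [Ioc_mem_nhdsGT (show (0 : ℝ) < 1 from one_pos)] with ε hε using hε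
  refine intervalIntegral.tendsto_integral_filter_of_dominated_convergence (logMajorant T b M r)
    ?_ ?_ (intervalIntegrable_logMajorant T b M r) ?_
  · filter_upwards [hev] with ε hε
    rw [uIoc_of_le hb]
    have h1 : Continuous fun t : ℝ =>
        t * T (Complex.log (((t ^ 2 - r ^ 2 : ℝ) : ℂ) + ε * Complex.I)) := by
      refine continuous_id.mul (T.continuous.comp (Continuous.clog (by fun_prop) fun t => ?_))
      exact Complex.mem_slitPlane_iff.2 (Or.inr (im_ofReal_add_pos hε.1 _).ne')
    exact ((h1.continuousOn.smul hG).mono Ioc_subset_Icc_self).aestronglyMeasurable measurableSet_Ioc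
  · filter_upwards [hev] with ε hε
    filter_upwards [Measure.ae_ne volume r] with t htr ht
    rw [uIoc_of_le hb] at ht
    exact norm_log_kernel_smul_le T hr hrb hM hε.1 hε.2 ht htr
  · filter_upwards [Measure.ae_ne volume r] with t htr ht
    rw [uIoc_of_le hb] at ht
    refine ((tendsto_apply_log T ?_).const_mul t).smul_const _
    rw [show t ^ 2 - r ^ 2 = (t - r) * (t + r) by ring]
    have : 0 < t + r := by linarith [ht.1]
    exact mul_ne_zero (sub_ne_zero.2 htr) this.ne'

end LogLimit

end SphericalMeans

namespace SphericalMeans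

variable {𝕜 : Type*} [RCLike 𝕜]

/-! ### The regularized kernel integrated over the sphere -/

section SphereKernel

variable (T : ℂ →L[ℝ] ℝ) {n : ℕ}

/-- The regularized kernel `|y - ξ|² - |x - ξ|² + iε`, inverted. -/
noncomputable def invKernel (ε : ℝ) (x ξ y : E n) : ℂ :=
  (((‖y - ξ‖ ^ 2 - ‖x - ξ‖ ^ 2 : ℝ) : ℂ) + ε * Complex.I)⁻¹

theorem continuous_invKernel {ε : ℝ} (hε : 0 < ε) (x : E n) :
    Continuous fun q : E n × E n => invKernel ε x q.1 q.2 :=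
  Continuous.inv₀ (by fun_prop) fun q => ofReal_add_ne_zero hε _

theorem norm_invKernel_le {ε : ℝ} (hε : 0 < ε) (x ξ y : E n) : ‖invKernel ε x ξ y‖ ≤ ε⁻¹ := by
  have := norm_inv_sub_ofReal_le (im_ofReal_add_pos hε (‖y - ξ‖ ^ 2 - ‖x - ξ‖ ^ 2)) 0
  rw [Complex.ofReal_zero, sub_zero, im_ofReal_add_mul_I] at this
  exact this

/-- The normalization `σ_{n-2}` of the zonal measure. -/
noncomputable def zonalConst (p : ℕ) : ℝ := ((p + 2 : ℕ) : ℝ) * volume.real (ball (0 : E (p + 2)) 1)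

/-- The terms |ξ|² cancel in |y-ξ|² - |x-ξ|², leaving a function of the component of ξ along y - x
only; the zonal formula then applies. -/
theorem integral_sphere_invKernel (p : ℕ) {R : ℝ} (hR : 0 < R) {ε : ℝ} (hε : 0 < ε)
    {x y : E (p + 3)} (hxy : x ≠ y) :
    ∫ ξ, T (invKernel ε x ξ y ^ (p + 1)) ∂(sphereMeasure (p + 3) R) =
      R ^ (p + 2) * ((2 * R * ‖x - y‖)⁻¹ ^ (p + 1) * (zonalConst p *
        T (cauchySin (p + 1) (p + 1) (((‖y‖ ^ 2 - ‖x‖ ^ 2) / (2 * R * ‖x - y‖) : ℝ) +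
          (ε / (2 * R * ‖x - y‖) : ℝ) * Complex.I)))) := by
  have hd : 0 < ‖x - y‖ := norm_pos_iff.2 (sub_ne_zero.2 hxy)
  set a : ℝ := 2 * R * ‖x - y‖ with ha
  have hapos : 0 < a := by positivity
  set z : ℂ := (((‖y‖ ^ 2 - ‖x‖ ^ 2) / a : ℝ) : ℂ) + (ε / a : ℝ) * Complex.I with hz
  have hzim : 0 < z.im := im_ofReal_add_pos (by positivity) _
  set e : E (p + 3) := ‖x - y‖⁻¹ • (y - x) with he
  have henorm : ‖e‖ = 1 := by
    rw [he, norm_smul, norm_sub_rev y x, norm_inv, norm_norm]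
    field_simp
  have hcont : Continuous fun ξ => T (invKernel ε x ξ y ^ (p + 1)) :=
    T.continuous.comp (((continuous_invKernel hε x).comp
      (continuous_id.prodMk continuous_const)).pow _)
  rw [integral_sphereMeasure hR.le hcont.stronglyMeasurable]
  set g : ℝ → ℂ := fun s => (z - s)⁻¹ ^ (p + 1) with hg
  have hgc : Continuous g := (Continuous.inv₀ (by fun_prop) (sub_ofReal_ne_zero hzim)).pow _
  have hgb : ∀ s, ‖g s‖ ≤ z.im⁻¹ ^ (p + 1) := fun s => by
    rw [hg, norm_pow]
    exact pow_le_pow_left₀ (norm_nonneg _) (norm_inv_sub_ofReal_le hzim s) _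
  have hpt : ∀ θ : sphere (0 : E (p + 3)) 1, invKernel ε x (R • (θ : E (p + 3))) y ^ (p + 1) =
      ((a⁻¹ ^ (p + 1) : ℝ) : ℂ) * g (inner ℝ e (θ : E (p + 3))) := by
    intro θ
    have h1 : ‖y - R • (θ : E (p + 3))‖ ^ 2 - ‖x - R • (θ : E (p + 3))‖ ^ 2 =
        a * ((‖y‖ ^ 2 - ‖x‖ ^ 2) / a - inner ℝ e (θ : E (p + 3))) := by
      rw [norm_sub_sq_real, norm_sub_sq_real, he, real_inner_smul_left, inner_smul_right,
        inner_smul_right, inner_sub_left, mul_sub, mul_div_cancel₀ _ hapos.ne', ha]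
      field_simp
      ring
    rw [invKernel, h1, hg]
    simp only
    rw [Complex.ofReal_pow, ← mul_pow, Complex.ofReal_inv, ← mul_inv]
    congr 2
    rw [hz]
    have : (a : ℂ) ≠ 0 := by exact_mod_cast hapos.ne'
    push_cast
    field_simp
    ring
  have hzon := integral_sphere_zonal (m := p + 2) (by omega) henorm hgc hgb
  have hgi : Integrable (fun θ : sphere (0 : E (p + 3)) 1 => g (inner ℝ e (θ : E (p + 3))))
      (unitSphereMeasure (p + 3)) :=
    Integrable.of_bound (Continuous.aestronglyMeasurable (hgc.comp (by fun_prop))) _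
      (ae_of_all _ fun θ => hgb _)
  simp_rw [hpt, ← Complex.real_smul, map_smul]
  rw [integral_smul, T.integral_comp_comm hgi, hzon, smul_eq_mul, smul_eq_mul, map_smul, smul_eq_mul]
  congr 3
  · rw [cauchySin]
    congr 1
    refine intervalIntegral.integral_congr fun t _ => ?_
    simp only [hg, Complex.real_smul]
    push_cast
    rfl

/-- Factor |y|² - |x|² and use ||y| - |x|| ≤ |x-y|. With r < R this keeps h in a compact part of
(-1, 1), which is why x and the support must lie inside the ball. -/
theorem abs_norm_sq_sub_div_le {R r : ℝ} (hR : 0 < R) {x y : E n} (hx : ‖x‖ ≤ r)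
    (hy : ‖y‖ ≤ r) (hxy : x ≠ y) : |(‖y‖ ^ 2 - ‖x‖ ^ 2) / (2 * R * ‖x - y‖)| ≤ r / R := by
  have hd : 0 < ‖x - y‖ := norm_pos_iff.2 (sub_ne_zero.2 hxy)
  have h1 := abs_norm_sub_norm_le y x
  rw [norm_sub_rev] at h1
  rw [abs_div, abs_of_pos (show 0 < 2 * R * ‖x - y‖ by positivity), div_le_div_iff₀ (by positivity) hR,
    show ‖y‖ ^ 2 - ‖x‖ ^ 2 = (‖y‖ - ‖x‖) * (‖y‖ + ‖x‖) by ring, abs_mul,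
    abs_of_nonneg (show 0 ≤ ‖y‖ + ‖x‖ by positivity)]
  have h2 : |‖y‖ - ‖x‖| * (‖y‖ + ‖x‖) ≤ ‖x - y‖ * (2 * r) := by
    gcongr
    linarith
  nlinarith

variable {f : E n → 𝕜} {R ρ : ℝ}

theorem integral_sphere_integral_invKernel_swap {ε : ℝ} (hε : 0 < ε) (x : E n) (k : ℕ)
    (hf : Continuous f) (hfc : HasCompactSupport f) :
    ∫ ξ, (∫ y, T (invKernel ε x ξ y ^ k) • f y) ∂(sphereMeasure n R) =
      ∫ y, (∫ ξ, T (invKernel ε x ξ y ^ k) ∂(sphereMeasure n R)) • f y := by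
  have hc : Continuous fun q : E n × E n => T (invKernel ε x q.1 q.2 ^ k) :=
    T.continuous.comp ((continuous_invKernel hε x).pow k)
  have hint : Integrable (Function.uncurry fun ξ y => T (invKernel ε x ξ y ^ k) • f y)
      ((sphereMeasure n R).prod volume) := by
    have h1 : Integrable (fun q : E n × E n => f q.2) ((sphereMeasure n R).prod volume) :=
      (hf.integrable_of_hasCompactSupport hfc).comp_snd _
    refine h1.bdd_smul (‖T‖ * ε⁻¹ ^ k)
      hc.aestronglyMeasurable (ae_of_all _ fun q => ?_)
    refine (T.le_opNorm _).trans ?_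
    rw [norm_pow]
    gcongr
    exact norm_invKernel_le hε _ _ _
  rw [integral_integral_swap hint]
  simp_rw [integral_smul_const]

end SphereKernel

/-! ### The limit: backprojection gives the Newtonian potential -/

section Limit

variable (T : ℂ →L[ℝ] ℝ) {p : ℕ} {f : E (p + 3) → 𝕜} {R ρ : ℝ}

theorem newtonPotential_eq {n : ℕ} (f : E n → 𝕜) (x : E n) :
    newtonPotential f x = ∫ y, (‖x - y‖ ^ (n - 2))⁻¹ • f y := by
  rw [newtonPotential, ← integral_sub_left_eq_self (fun y => (‖x - y‖ ^ (n - 2))⁻¹ • f y) volume x]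
  simp only [sub_sub_cancel]

/-- After the sphere integration only |x-y|^{2-n} times a uniformly bounded factor remains.
Dominated convergence applies, and the limit of that factor is the same for every y ≠ x with f(y) ≠
0. -/
theorem tendsto_integral_invKernel (hT : ∀ r : ℝ, T ((-Complex.I) ^ (p + 2) * r) = 0)
    (hf : Continuous f) (hfc : HasCompactSupport f) (hR : 0 < R) (hρR : ρ < R)
    (hs : ∀ y, ρ < ‖y‖ → f y = 0) {x : E (p + 3)} (hx : x ∈ ball (0 : E (p + 3)) R) :
    Tendsto (fun ε : ℝ => ∫ y, (∫ ξ, T (invKernel ε x ξ y ^ (p + 1)) ∂(sphereMeasure (p + 3) R)) • f y)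
      (𝓝[>] 0) (𝓝 ((R ^ (p + 2) * ((2 * R)⁻¹ ^ (p + 1) * (zonalConst p *
        (Real.pi * T ((-Complex.I) ^ (p + 1)))))) • newtonPotential f x)) := by
  set r : ℝ := max ‖x‖ ρ with hr
  have hrR : r < R := max_lt (by simpa using hx) hρR
  obtain ⟨B, hB⟩ := norm_cauchySin_le p (ρ := r / R) ((div_lt_one hR).2 hrR)
  have hmain : ∀ y, f y ≠ 0 → ‖y‖ ≤ r := fun y hy => by
    by_contra! h
    exact hy (hs y ((le_max_right _ _).trans_lt h))
  have hx' : ‖x‖ ≤ r := le_max_left _ _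
  have hne : ∀ᵐ y : E (p + 3), y ≠ x := Measure.ae_ne volume x
  have hint : Integrable fun y : E (p + 3) => (‖x - y‖ ^ (p + 1))⁻¹ • f y := by
    have h1 := (integrable_smul_sub (locallyIntegrable_newton (n := p + 3) (by omega)) hf hfc
      x).comp_sub_left x
    refine h1.congr (ae_of_all _ fun y => ?_)
    simp only [sub_sub_cancel]
    rfl
  set c : ℝ := R ^ (p + 2) * ((2 * R)⁻¹ ^ (p + 1) * zonalConst p) with hc
  have hκ : 0 ≤ zonalConst p := by unfold zonalConst; positivity
  have hc0 : 0 ≤ c := by positivity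
  have hker : ∀ ε : ℝ, 0 < ε → ∀ y, y ≠ x →
      ∫ ξ, T (invKernel ε x ξ y ^ (p + 1)) ∂(sphereMeasure (p + 3) R) =
        c * T (cauchySin (p + 1) (p + 1) (((‖y‖ ^ 2 - ‖x‖ ^ 2) / (2 * R * ‖x - y‖) : ℝ) +
          (ε / (2 * R * ‖x - y‖) : ℝ) * Complex.I)) * (‖x - y‖ ^ (p + 1))⁻¹ := by
    intro ε hε y hy
    rw [integral_sphere_invKernel T p hR hε hy.symm, mul_inv (2 * R), mul_pow, hc, inv_pow ‖x - y‖]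
    ring
  have hlim : (R ^ (p + 2) * ((2 * R)⁻¹ ^ (p + 1) * (zonalConst p *
      (Real.pi * T ((-Complex.I) ^ (p + 1)))))) • newtonPotential f x =
      ∫ y, (c * (Real.pi * T ((-Complex.I) ^ (p + 1))) * (‖x - y‖ ^ (p + 1))⁻¹) • f y := by
    rw [newtonPotential_eq, ← integral_smul]
    refine integral_congr_ae (ae_of_all _ fun y => ?_)
    simp only [smul_smul]
    rw [hc]
    congr 1
    rw [show p + 3 - 2 = p + 1 from rfl]
    ring
  rw [hlim]
  refine tendsto_integral_filter_of_dominated_convergence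
    (fun y => c * (‖T‖ * B) * ‖(‖x - y‖ ^ (p + 1))⁻¹ • f y‖) ?_ ?_ (hint.norm.const_mul _) ?_
  · filter_upwards [self_mem_nhdsWithin] with ε (hε : 0 < ε)
    have hcK : Continuous fun q : E (p + 3) × E (p + 3) => T (invKernel ε x q.2 q.1 ^ (p + 1)) :=
      T.continuous.comp (((continuous_invKernel hε x).comp continuous_swap).pow _)
    have hm := hcK.stronglyMeasurable.integral_prod_right
      (f := fun y ξ => T (invKernel ε x ξ y ^ (p + 1))) (ν := sphereMeasure (p + 3) R)
    exact hm.aestronglyMeasurable.smul hf.aestronglyMeasurable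
  · filter_upwards [self_mem_nhdsWithin] with ε (hε : 0 < ε)
    filter_upwards [hne] with y hy
    by_cases hfy : f y = 0
    · simp [hfy]
    have hd : 0 < ‖x - y‖ := norm_pos_iff.2 (sub_ne_zero.2 hy.symm)
    have h1 := hB _ (abs_norm_sq_sub_div_le hR hx' (hmain y hfy) hy.symm)
      (ε / (2 * R * ‖x - y‖)) (by positivity)
    rw [hker ε hε y hy, norm_smul, norm_smul, norm_mul, norm_mul, Real.norm_of_nonneg hc0, mul_assoc]
    gcongr
    exact (T.le_opNorm _).trans (mul_le_mul_of_nonneg_left h1 (norm_nonneg T))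
  · filter_upwards [hne] with y hy
    by_cases hfy : f y = 0
    · simp [hfy]
    have hd : 0 < ‖x - y‖ := norm_pos_iff.2 (sub_ne_zero.2 hy.symm)
    have h1 := (abs_norm_sq_sub_div_le hR hx' (hmain y hfy) hy.symm).trans_lt
      ((div_lt_one hR).2 hrR)
    have h2 : Tendsto (fun ε : ℝ => ε / (2 * R * ‖x - y‖)) (𝓝[>] 0) (𝓝[>] 0) := by
      refine tendsto_nhdsWithin_iff.2 ⟨?_, ?_⟩
      · have : Continuous fun ε : ℝ => ε / (2 * R * ‖x - y‖) := by fun_prop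
        have h := this.tendsto 0
        simp only [zero_div] at h
        exact h.mono_left nhdsWithin_le_nhds
      · filter_upwards [self_mem_nhdsWithin] with ε (hε : 0 < ε)
        exact div_pos hε (by positivity)
    have h3 := (((tendsto_cauchySin p T hT h1).comp h2).const_mul c).mul_const
      ((‖x - y‖ ^ (p + 1))⁻¹)
    refine Tendsto.smul_const (h3.congr' ?_) _
    filter_upwards [self_mem_nhdsWithin] with ε hε
    rw [hker ε hε y hy]
    rfl

theorem exists_norm_filteredMean_le {n : ℕ} {f : E n → 𝕜} (hf : ContDiff ℝ ∞ f) (hρR : ρ < R)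
    (hs : ∀ y, ρ < ‖y‖ → f y = 0) (k : ℕ) :
    ∃ M, 0 ≤ M ∧ ∀ ξ ∈ sphere (0 : E n) R, ∀ t, 0 ≤ t → ‖filteredMean k f ξ t‖ ≤ M := by
  have hK : IsCompact (sphere (0 : E n) R ×ˢ Icc (R - ρ) (2 * R)) :=
    (isCompact_sphere _ _).prod isCompact_Icc
  have hc : ContinuousOn (fun q : E n × ℝ => filteredMean k f q.1 q.2)
      (sphere (0 : E n) R ×ˢ Icc (R - ρ) (2 * R)) :=
    (contDiffOn_filteredMean hf k).continuousOn.mono fun q hq =>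
      ⟨mem_univ _, lt_of_lt_of_le (by linarith) hq.2.1⟩
  obtain ⟨M, hM⟩ := hK.exists_bound_of_continuousOn hc
  refine ⟨max M 0, le_max_right _ _, fun ξ hξ t ht => ?_⟩
  have hb := isBump_filteredMean hf hs hξ k
  by_cases h1 : t < R - ρ
  · rw [hb.eq_zero_left t (by rwa [abs_of_nonneg ht]), norm_zero]
    exact le_max_right _ _
  by_cases h2 : 2 * R < t
  · rw [hb.eq_zero_right t (by linarith), norm_zero]
    exact le_max_right _ _
  exact (hM (ξ, t) ⟨hξ, not_lt.1 h1, not_lt.1 h2⟩).trans (le_max_left _ _)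

theorem continuousOn_filteredMean {n : ℕ} {f : E n → 𝕜} (hf : ContDiff ℝ ∞ f) (hρR : ρ < R)
    (hs : ∀ y, ρ < ‖y‖ → f y = 0) {ξ : E n} (hξ : ξ ∈ sphere (0 : E n) R) (k : ℕ) :
    ContinuousOn (filteredMean k f ξ) (Ici 0) := fun _ ht =>
  ((isBump_filteredMean hf hs hξ k).contDiffAt (by linarith) ht).continuousAt.continuousWithinAt

/-- Backprojection with a logarithmic kernel gives a multiple of the Newtonian potential. -/
theorem integral_log_filteredMean (hT : ∀ r : ℝ, T ((-Complex.I) ^ (p + 2) * r) = 0)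
    (hf : ContDiff ℝ ∞ f) (hfc : HasCompactSupport f) (hR : 0 < R) (hρR : ρ < R)
    (hs : ∀ y, ρ < ‖y‖ → f y = 0) {x : E (p + 3)} (hx : x ∈ ball (0 : E (p + 3)) R) :
    Integrable (fun ξ => ∫ t in (0 : ℝ)..(2 * R),
        (t * T (Complex.log ((t ^ 2 - ‖x - ξ‖ ^ 2 : ℝ) : ℂ))) • filteredMean (p + 1) f ξ t)
      (sphereMeasure (p + 3) R) ∧
    ∫ ξ, (∫ t in (0 : ℝ)..(2 * R),
        (t * T (Complex.log ((t ^ 2 - ‖x - ξ‖ ^ 2 : ℝ) : ℂ))) • filteredMean (p + 1) f ξ t)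
      ∂(sphereMeasure (p + 3) R) =
      (-((p ! : ℝ) * ((unitSphereMeasure (p + 3)).real univ)⁻¹)) • (R ^ (p + 2) *
        ((2 * R)⁻¹ ^ (p + 1) * (zonalConst p * (Real.pi * T ((-Complex.I) ^ (p + 1)))))) •
          newtonPotential f x := by
  obtain ⟨M, hM0, hM⟩ := exists_norm_filteredMean_le hf hρR hs (p + 1)
  have hxn : ‖x‖ < R := by simpa using hx
  set I₀ : E (p + 3) → 𝕜 := fun ξ => ∫ t in (0 : ℝ)..(2 * R),
    (t * T (Complex.log ((t ^ 2 - ‖x - ξ‖ ^ 2 : ℝ) : ℂ))) • filteredMean (p + 1) f ξ t with hI₀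
  set A : ℝ → E (p + 3) → 𝕜 := fun ε ξ => ∫ y, T (invKernel ε x ξ y ^ (p + 1)) • f y with hA
  set q : ℝ := -((p ! : ℝ) * ((unitSphereMeasure (p + 3)).real univ)⁻¹) with hq
  set K : ℝ := (2 * R) * (‖T‖ * (2 * (∫ t in (-(2 * (2 * R)))..(2 * (2 * R)), |Real.log t|) +
    (2 * R) * (|Real.log ((2 * R) ^ 2 + 1)| + Real.pi))) * M with hK
  have hrad : ∀ ξ ∈ sphere (0 : E (p + 3)) R, ‖x - ξ‖ ≤ 2 * R := fun ξ hξ => by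
    have h1 := norm_sub_le x ξ
    rw [show ‖ξ‖ = R by simpa using hξ] at h1
    linarith
  have hrepr : ∀ ε : ℝ, 0 < ε → ∀ ξ ∈ sphere (0 : E (p + 3)) R,
      ∫ t in (0 : ℝ)..(2 * R), (t * T (Complex.log (((t ^ 2 - ‖x - ξ‖ ^ 2 : ℝ) : ℂ) +
        ε * Complex.I))) • filteredMean (p + 1) f ξ t = q • A ε ξ := fun ε hε ξ hξ =>
    integral_log_kernel_filteredMean T (‖x - ξ‖ ^ 2) (by omega) hf hfc hR.le hρR hs hξ hε p
  have hlim : ∀ ξ ∈ sphere (0 : E (p + 3)) R, Tendsto (fun ε => q • A ε ξ) (𝓝[>] 0) (𝓝 (I₀ ξ)) := by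
    intro ξ hξ
    refine (tendsto_integral_log_kernel T (norm_nonneg _) (by positivity) (hrad ξ hξ) (hM ξ hξ)
      ((continuousOn_filteredMean hf hρR hs hξ _).mono fun t ht => ht.1)).congr' ?_
    filter_upwards [self_mem_nhdsWithin] with ε hε using hrepr ε hε ξ hξ
  have hbound : ∀ ε : ℝ, 0 < ε → ε ≤ 1 → ∀ ξ ∈ sphere (0 : E (p + 3)) R, ‖q • A ε ξ‖ ≤ K := by
    intro ε hε hε1 ξ hξ
    rw [← hrepr ε hε ξ hξ]
    exact norm_integral_log_kernel_le T (norm_nonneg _) (by positivity) (hrad ξ hξ) (hM ξ hξ) hε hε1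
  have hev : ∀ᶠ ε : ℝ in 𝓝[>] 0, 0 < ε ∧ ε ≤ 1 := by
    filter_upwards [Ioc_mem_nhdsGT (show (0 : ℝ) < 1 from one_pos)] with ε hε using hε
  have hmeas : ∀ᶠ ε : ℝ in 𝓝[>] 0, AEStronglyMeasurable (fun ξ => q • A ε ξ)
      (sphereMeasure (p + 3) R) := by
    filter_upwards [hev] with ε hε
    have hc : Continuous fun s : E (p + 3) × E (p + 3) => T (invKernel ε x s.1 s.2 ^ (p + 1)) • f s.2 :=
      (T.continuous.comp ((continuous_invKernel hε.1 x).pow _)).smul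
        (hf.continuous.comp continuous_snd)
    exact (hc.stronglyMeasurable.integral_prod_right.const_smul q).aestronglyMeasurable
  have hlim_ae : ∀ᵐ ξ ∂(sphereMeasure (p + 3) R),
      Tendsto (fun ε => q • A ε ξ) (𝓝[>] 0) (𝓝 (I₀ ξ)) :=
    (ae_mem_sphere hR.le).mono hlim
  have hbound_ae : ∀ᶠ ε : ℝ in 𝓝[>] 0, ∀ᵐ ξ ∂(sphereMeasure (p + 3) R), ‖q • A ε ξ‖ ≤ K := by
    filter_upwards [hev] with ε hε using (ae_mem_sphere hR.le).mono (hbound ε hε.1 hε.2)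
  have hDCT := tendsto_integral_filter_of_dominated_convergence (fun _ => K) hmeas hbound_ae
    (integrable_const K) hlim_ae
  -- Measurability in ξ is inherited from the regularized integrals along ε = 1/(m+1), shifted so
  -- that every term is measurable.
  have hI₀meas : AEStronglyMeasurable I₀ (sphereMeasure (p + 3) R) := by
    have hseq : Tendsto (fun m : ℕ => 1 / ((m : ℝ) + 1)) atTop (𝓝[>] 0) :=
      tendsto_nhdsWithin_iff.2 ⟨tendsto_one_div_add_atTop_nhds_zero_nat,
        Eventually.of_forall fun m => by
          have : (0 : ℝ) < 1 / ((m : ℝ) + 1) := by positivity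
          exact this⟩
    obtain ⟨N, hN⟩ := eventually_atTop.1 (hseq.eventually hmeas)
    refine aestronglyMeasurable_of_tendsto_ae (u := atTop)
      (f := fun (m : ℕ) ξ => q • A (1 / (((m + N : ℕ) : ℝ) + 1)) ξ)
      (fun m => hN (m + N) (Nat.le_add_left _ _)) ?_
    filter_upwards [hlim_ae] with ξ hξ
    exact hξ.comp (hseq.comp (tendsto_add_atTop_nat N))
  refine ⟨Integrable.of_bound hI₀meas K ?_, ?_⟩
  · filter_upwards [ae_mem_sphere hR.le] with ξ hξ
    refine le_of_tendsto (hlim ξ hξ).norm ?_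
    filter_upwards [hev] with ε hε using hbound ε hε.1 hε.2 ξ hξ
  -- The same regularized integral has two limits: the backprojection, by dominated convergence in
  -- ξ, and the Newtonian potential, after exchanging the ξ and y integrals.
  · refine tendsto_nhds_unique hDCT ?_
    refine ((tendsto_integral_invKernel T hT hf.continuous hfc hR hρR hs hx).const_smul q).congr' ?_
    filter_upwards [self_mem_nhdsWithin] with ε hε
    rw [integral_smul, hA]
    rw [integral_sphere_integral_invKernel_swap T hε x (p + 1) hf.continuous hfc]

end Limit

end SphericalMeans

namespace SphericalMeans

variable {𝕜 : Type*} [RCLike 𝕜]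

/-! ### Evaluation of the constants -/

section Constants

theorem zonalConst_eq (p : ℕ) :
    zonalConst p * Real.Gamma ((p + 2 : ℝ) / 2) = 2 * Real.pi ^ ((p + 2 : ℝ) / 2) := by
  have hpos : (0 : ℝ) < (p + 2 : ℝ) / 2 := by positivity
  have hG := Real.Gamma_add_one hpos.ne'
  have hGpos := Real.Gamma_pos_of_pos hpos
  rw [zonalConst, measureReal_def, EuclideanSpace.volume_ball]
  simp only [ENNReal.ofReal_one, one_pow, one_mul, Fintype.card_fin]
  rw [ENNReal.toReal_ofReal (by positivity)]
  push_cast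
  rw [hG, Real.sqrt_eq_rpow, ← Real.rpow_natCast, ← Real.rpow_mul Real.pi_pos.le]
  rw [show (1 / 2 : ℝ) * ((p + 2 : ℕ) : ℝ) = (p + 2 : ℝ) / 2 by push_cast; ring]
  field_simp

/-- Legendre's duplication formula at (p+2)/2, combined with the area of the unit sphere of ℝ^{p+2}.
-/
theorem factorial_mul_zonalConst (p : ℕ) :
    ((p + 1)! : ℝ) * (2⁻¹ ^ (p + 1) * (zonalConst p * Real.pi)) =
      2 * Real.pi ^ ((p + 3 : ℝ) / 2) * Real.Gamma ((p + 3 : ℝ) / 2) := by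
  have hpos : (0 : ℝ) < (p + 2 : ℝ) / 2 := by positivity
  have hGpos := Real.Gamma_pos_of_pos hpos
  have h1 := Real.Gamma_mul_Gamma_add_half ((p + 2 : ℝ) / 2)
  rw [show (p + 2 : ℝ) / 2 + 1 / 2 = (p + 3) / 2 by ring,
    show 2 * ((p + 2 : ℝ) / 2) = ((p + 1 : ℕ) : ℝ) + 1 by push_cast; ring,
    Real.Gamma_nat_eq_factorial,
    show (1 : ℝ) - (((p + 1 : ℕ) : ℝ) + 1) = -((p + 1 : ℕ) : ℝ) by ring,
    Real.rpow_neg (by norm_num), Real.rpow_natCast, ← inv_pow] at h1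
  have h2 := zonalConst_eq p
  have h3 : Real.pi ^ ((p + 3 : ℝ) / 2) = Real.pi ^ ((p + 2 : ℝ) / 2) * Real.sqrt Real.pi := by
    rw [Real.sqrt_eq_rpow, ← Real.rpow_add Real.pi_pos]
    congr 1; ring
  have h4 : Real.sqrt Real.pi * Real.sqrt Real.pi = Real.pi := Real.mul_self_sqrt Real.pi_pos.le
  have h5 : Real.Gamma ((p + 2 : ℝ) / 2) * (((p + 1)! : ℝ) * (2⁻¹ ^ (p + 1) * (zonalConst p * Real.pi))) =
      Real.Gamma ((p + 2 : ℝ) / 2) *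
        (2 * Real.pi ^ ((p + 3 : ℝ) / 2) * Real.Gamma ((p + 3 : ℝ) / 2)) := by
    rw [h3]
    linear_combination ((p + 1)! : ℝ) * 2⁻¹ ^ (p + 1) * Real.pi * h2 -
      2 * Real.pi ^ ((p + 2 : ℝ) / 2) * Real.sqrt Real.pi * h1 -
      2 * Real.pi ^ ((p + 2 : ℝ) / 2) * ((p + 1)! : ℝ) * 2⁻¹ ^ (p + 1) * h4
  exact mul_left_cancel₀ hGpos.ne' h5

end Constants

/-! ### From the Newtonian potential to the two inversion formulas -/

section Inversion

variable {p : ℕ} {f : E (p + 3) → 𝕜} {R ρ : ℝ}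

/-- A function agreeing on the ball with the multiple of the Newtonian potential produced by the
backprojection is smooth there and its Laplacian is a multiple of `f`. -/
theorem laplacian_of_eq_smul_newtonPotential (hf : ContDiff ℝ ∞ f) (hfc : HasCompactSupport f)
    (hR : 0 < R) (c τ : ℝ) {I : E (p + 3) → 𝕜}
    (hI : ∀ x ∈ ball (0 : E (p + 3)) R, I x =
      c • (-((p ! : ℝ) * ((unitSphereMeasure (p + 3)).real univ)⁻¹)) • (R ^ (p + 2) *
        ((2 * R)⁻¹ ^ (p + 1) * (zonalConst p * (Real.pi * τ)))) • newtonPotential f x) :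
    ContDiffOn ℝ 2 I (ball 0 R) ∧ ∀ x ∈ ball (0 : E (p + 3)) R, Laplacian.laplacian I x =
      (c * τ * R * (2 * Real.pi ^ ((p + 3 : ℝ) / 2) * Real.Gamma ((p + 3 : ℝ) / 2))) • f x := by
  set σ := (unitSphereMeasure (p + 3)).real univ with hσ
  have hσpos : 0 < σ := unitSphereMeasure_real_pos (by omega)
  set C : ℝ := c * (-((p ! : ℝ) * σ⁻¹) * (R ^ (p + 2) *
    ((2 * R)⁻¹ ^ (p + 1) * (zonalConst p * (Real.pi * τ))))) with hC
  have hI' : ∀ x ∈ ball (0 : E (p + 3)) R, I x = (C • newtonPotential f) x := fun x hx => by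
    rw [hI x hx, Pi.smul_apply, hC, smul_smul, smul_smul, mul_assoc c]
  have hN : ContDiff ℝ ∞ (newtonPotential f) := contDiff_newtonPotential (by omega) hf hfc
  have hN2 : ContDiff ℝ 2 (newtonPotential f) := contDiff_infty.1 hN 2
  refine ⟨(hN2.const_smul C).contDiffOn.congr hI', fun x hx => ?_⟩
  have h1 : I =ᶠ[𝓝 x] C • newtonPotential f := by
    filter_upwards [isOpen_ball.mem_nhds hx] with y hy using hI' y hy
  rw [(InnerProductSpace.laplacian_congr_nhds h1).eq_of_nhds,
    InnerProductSpace.laplacian_smul C hN2.contDiffAt,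
    laplacian_newtonPotential (by omega) hf hfc, smul_smul]
  congr 1
  -- The factor n - 2 = p + 1 from the Laplacian completes p! to (p+1)!, the sphere area cancels,
  -- and one power of R survives.
  rw [← factorial_mul_zonalConst, hC, Nat.factorial_succ, mul_inv, mul_pow,
    pow_succ R (p + 1), inv_pow R]
  push_cast
  field_simp
  ring

variable {n : ℕ} {g : E n → 𝕜}

/-- The imaginary part of log(t² - r²) is π for t < r and 0 for t ≥ r, while t · D = (1/2) d/dt. The
integral is then (π/2) times that of a derivative over (0, r), with no contribution at 0. -/
theorem integral_im_log_smul_filteredMean (hg : ContDiff ℝ ∞ g) (hR : 0 ≤ R) (hρR : ρ < R)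
    (hs : ∀ y, ρ < ‖y‖ → g y = 0) {ξ : E n} (hξ : ξ ∈ sphere (0 : E n) R) (k : ℕ) {r : ℝ}
    (hr : 0 < r) (hrR : r ≤ 2 * R) :
    ∫ t in (0 : ℝ)..(2 * R), (t * Complex.imCLM (Complex.log ((t ^ 2 - r ^ 2 : ℝ) : ℂ))) •
      filteredMean (k + 1) g ξ t = (Real.pi / 2) • filteredMean k g ξ r := by
  have hδ : 0 < R - ρ := by linarith
  have hb := isBump_filteredMean hg hs hξ k
  have h1 : filteredMean (k + 1) g ξ = opD (filteredMean k g ξ) := by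
    simp only [filteredMean, Function.iterate_succ_apply']
  set G := filteredMean k g ξ with hG
  have hdG : ContinuousOn (deriv G) (Icc 0 (2 * R)) := fun t ht =>
    (((hb.contDiffAt hδ ht.1).continuousAt_fderiv (by simp)).clm_apply
      continuousAt_const).continuousWithinAt
  have hcongr : ∀ t ∈ Ioc 0 (2 * R),
      (t * Complex.imCLM (Complex.log ((t ^ 2 - r ^ 2 : ℝ) : ℂ))) • opD G t =
        (Iio r).indicator (fun t => (Real.pi / 2) • deriv G t) t := by
    intro t ht
    rw [Complex.imCLM_apply, Complex.log_im]
    by_cases htr : t < r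
    · have h2 : t ^ 2 - r ^ 2 < 0 := by nlinarith [ht.1]
      rw [indicator_of_mem (show t ∈ Iio r from htr), Complex.arg_ofReal_of_neg h2, opD, smul_smul]
      congr 1
      have := ht.1.ne'
      field_simp
    · have h2 : 0 ≤ t ^ 2 - r ^ 2 := by nlinarith [not_lt.1 htr]
      rw [indicator_of_notMem (show t ∉ Iio r from htr), Complex.arg_ofReal_of_nonneg h2]
      simp
  have hset : Ioc 0 (2 * R) ∩ Iio r = Ioo 0 r := by
    ext t
    simp only [mem_inter_iff, mem_Ioc, mem_Iio, mem_Ioo]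
    constructor
    · rintro ⟨⟨h1, -⟩, h2⟩; exact ⟨h1, h2⟩
    · rintro ⟨h1, h2⟩; exact ⟨⟨h1, h2.le.trans hrR⟩, h2⟩
  rw [h1, intervalIntegral.integral_of_le (by positivity),
    setIntegral_congr_fun measurableSet_Ioc hcongr, setIntegral_indicator measurableSet_Iio, hset,
    ← integral_Ioc_eq_integral_Ioo, ← intervalIntegral.integral_of_le hr.le,
    intervalIntegral.integral_smul]
  congr 1
  rw [intervalIntegral.integral_deriv_eq_sub, hb.eq_zero_left 0 (by simpa using hδ), sub_zero]
  · intro t ht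
    rw [uIcc_of_le hr.le] at ht
    exact (hb.contDiffAt hδ ht.1).differentiableAt (by simp)
  · refine (hdG.mono ?_).intervalIntegrable
    rw [uIcc_of_le hr.le]
    exact Icc_subset_Icc_right hrR

theorem intervalIntegrable_evenIntegrand (hg : ContDiff ℝ ∞ g) (hR : 0 ≤ R) (hρR : ρ < R)
    (hs : ∀ y, ρ < ‖y‖ → g y = 0) (x : E n) {ξ : E n} (hξ : ξ ∈ sphere (0 : E n) R) :
    IntervalIntegrable (evenIntegrand g x ξ) volume 0 (2 * R) := by
  have h1 : IntervalIntegrable (fun t => Real.log |t ^ 2 - ‖x - ξ‖ ^ 2|) volume 0 (2 * R) := by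
    refine (intervalIntegrable_abs_log_sub_add ‖x - ξ‖ (2 * R)).mono_fun' ?_ ?_
    · exact (Real.measurable_log.comp (by fun_prop)).aestronglyMeasurable
    · refine ae_of_all _ fun t => ?_
      simp only [Real.log_abs, Real.norm_eq_abs]
      exact abs_log_sq_sub_sq_le
  have h2 := h1.continuousOn_mul (continuousOn_id (s := uIcc 0 (2 * R)))
  refine h2.smul_continuousOn ((continuousOn_filteredMean hg hρR hs hξ (n - 2)).mono fun t ht => ?_)
  rw [uIcc_of_le (by positivity)] at ht
  exact ht.1

end Inversion

section Support

theorem exists_radius_of_tsupport_subset {n : ℕ} {f : E n → 𝕜} {R : ℝ}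
    (hsupp : tsupport f ⊆ ball 0 R) :
    ∃ ρ < R, ∀ y, ρ < ‖y‖ → f y = 0 := by
  obtain ⟨ρ, hρ, hsub⟩ := exists_lt_subset_ball (isClosed_tsupport f) hsupp
  refine ⟨ρ, hρ, fun y hy => ?_⟩
  by_contra h
  have := hsub (subset_tsupport f (Function.mem_support.2 h))
  rw [mem_ball_zero_iff] at this
  linarith

end Support

theorem neg_I_pow_two_mul (j : ℕ) : (-Complex.I) ^ (2 * j) = ((-1 : ℝ) ^ j : ℝ) := by
  rw [pow_mul, neg_sq, Complex.I_sq]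
  simp

variable {p : ℕ} {f : E (p + 3) → 𝕜} {R : ℝ}

/-- Here p is even, so (-i)^{p+2} is real and the imaginary part kills its real multiples. The
step-function kernel collapses the t-integral to the value at t = |x-ξ|. -/
theorem odd_inversion (hf : ContDiff ℝ ∞ f) (hfc : HasCompactSupport f) (hR : 0 < R)
    (hsupp : tsupport f ⊆ ball 0 R) (hodd : Odd (p + 3)) :
    (∀ x ∈ ball (0 : E (p + 3)) R,
      Integrable (fun ξ => filteredMean p f ξ ‖x - ξ‖) (sphereMeasure (p + 3) R)) ∧
    ContDiffOn ℝ 2 (oddIntegral R f) (ball 0 R) ∧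
    ∀ x ∈ ball (0 : E (p + 3)) R,
      f x = dOdd (p + 3) R • Laplacian.laplacian (oddIntegral R f) x := by
  obtain ⟨ρ, hρR, hs⟩ := exists_radius_of_tsupport_subset hsupp
  obtain ⟨j, hj⟩ : ∃ j, p = 2 * j := by
    obtain ⟨m, hm⟩ := hodd
    exact ⟨m - 1, by omega⟩
  have hT : ∀ r : ℝ, Complex.imCLM ((-Complex.I) ^ (p + 2) * r) = 0 := by
    intro r
    rw [hj, show 2 * j + 2 = 2 * (j + 1) by ring, neg_I_pow_two_mul, ← Complex.ofReal_mul,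
      Complex.imCLM_apply, Complex.ofReal_im]
  have hτ : Complex.imCLM ((-Complex.I) ^ (p + 1)) = (-1) ^ (j + 1) := by
    rw [hj, pow_succ, neg_I_pow_two_mul, Complex.imCLM_apply, Complex.im_ofReal_mul, pow_succ,
      Complex.neg_im, Complex.I_im]
  have hpt : ∀ x ∈ ball (0 : E (p + 3)) R, ∀ ξ ∈ sphere (0 : E (p + 3)) R,
      (2 / Real.pi) • ∫ t in (0 : ℝ)..(2 * R),
        (t * Complex.imCLM (Complex.log ((t ^ 2 - ‖x - ξ‖ ^ 2 : ℝ) : ℂ))) •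
          filteredMean (p + 1) f ξ t = filteredMean p f ξ ‖x - ξ‖ := by
    intro x hx ξ hξ
    have hx' : ‖x‖ < R := by simpa using hx
    have hξ' : ‖ξ‖ = R := by simpa using hξ
    have h1 := norm_sub_le x ξ
    have h2 := norm_sub_norm_le ξ x
    rw [norm_sub_rev] at h2
    -- Since x is interior, 0 < R - |x| ≤ |x-ξ| ≤ 2R, as the evaluation requires.
    rw [integral_im_log_smul_filteredMean hf hR.le hρR hs hξ p (by linarith) (by linarith),
      smul_smul]
    have := Real.pi_pos.ne'
    rw [show 2 / Real.pi * (Real.pi / 2) = 1 by field_simp, one_smul]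
  have hae : ∀ x ∈ ball (0 : E (p + 3)) R, ∀ᵐ ξ ∂(sphereMeasure (p + 3) R),
      (2 / Real.pi) • ∫ t in (0 : ℝ)..(2 * R),
        (t * Complex.imCLM (Complex.log ((t ^ 2 - ‖x - ξ‖ ^ 2 : ℝ) : ℂ))) •
          filteredMean (p + 1) f ξ t = filteredMean p f ξ ‖x - ξ‖ :=
    fun x hx => (ae_mem_sphere hR.le).mono (hpt x hx)
  have hmain := fun x hx =>
    integral_log_filteredMean Complex.imCLM hT hf hfc hR hρR hs (x := x) hx
  have hΔ := laplacian_of_eq_smul_newtonPotential hf hfc hR (2 / Real.pi) ((-1) ^ (j + 1))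
    (I := oddIntegral R f) (fun x hx => by
      rw [← hτ, ← (hmain x hx).2, ← integral_smul]
      exact (integral_congr_ae (hae x hx)).symm)
  refine ⟨fun x hx => ((hmain x hx).1.smul (2 / Real.pi)).congr (hae x hx), hΔ.1, fun x hx => ?_⟩
  rw [hΔ.2 x hx, smul_smul]
  have hG := Real.Gamma_pos_of_pos (show (0 : ℝ) < (p + 3 : ℝ) / 2 by positivity)
  have hpi : Real.pi ^ (1 - (p + 3 : ℝ) / 2) * Real.pi ^ ((p + 3 : ℝ) / 2) = Real.pi := by
    rw [← Real.rpow_add Real.pi_pos]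
    simp
  have hsign : ((-1 : ℝ) ^ (j + 1)) * (-1) ^ (j + 1) = 1 := by
    rw [← mul_pow]; simp
  have hone : dOdd (p + 3) R * (2 / Real.pi * (-1) ^ (j + 1) * R *
      (2 * Real.pi ^ ((p + 3 : ℝ) / 2) * Real.Gamma ((p + 3 : ℝ) / 2))) = 1 := by
    rw [dOdd, show (p + 3 - 1) / 2 = j + 1 by omega]
    push_cast
    have := Real.pi_pos.ne'
    have h4 : (-1 : ℝ) ^ (j + 1) * Real.pi ^ (1 - (p + 3 : ℝ) / 2) /
        (4 * R * Real.Gamma ((p + 3 : ℝ) / 2)) * (2 / Real.pi * (-1) ^ (j + 1) * R *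
        (2 * Real.pi ^ ((p + 3 : ℝ) / 2) * Real.Gamma ((p + 3 : ℝ) / 2))) =
        ((-1) ^ (j + 1) * (-1) ^ (j + 1)) *
          (Real.pi ^ (1 - (p + 3 : ℝ) / 2) * Real.pi ^ ((p + 3 : ℝ) / 2)) / Real.pi := by
      field_simp
      ring
    rw [h4, hpi, hsign]
    field_simp
  rw [hone, one_smul]

/-- Here p is odd, so (-i)^{p+2} is purely imaginary and the real part kills its real multiples. The
real part of the logarithm is the kernel of the formula itself. -/
theorem even_inversion (hf : ContDiff ℝ ∞ f) (hfc : HasCompactSupport f) (hR : 0 < R)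
    (hsupp : tsupport f ⊆ ball 0 R) (heven : Even (p + 3)) :
    (∀ x ∈ ball (0 : E (p + 3)) R,
      (∀ ξ ∈ sphere (0 : E (p + 3)) R,
        IntervalIntegrable (evenIntegrand f x ξ) volume 0 (2 * R)) ∧
      Integrable (fun ξ => ∫ t in (0 : ℝ)..(2 * R), evenIntegrand f x ξ t)
        (sphereMeasure (p + 3) R)) ∧
    ContDiffOn ℝ 2 (evenIntegral R f) (ball 0 R) ∧
    ∀ x ∈ ball (0 : E (p + 3)) R,
      f x = dEven (p + 3) R • Laplacian.laplacian (evenIntegral R f) x := by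
  obtain ⟨ρ, hρR, hs⟩ := exists_radius_of_tsupport_subset hsupp
  obtain ⟨j, hj⟩ : ∃ j, p + 1 = 2 * j := by
    obtain ⟨m, hm⟩ := heven
    exact ⟨m - 1, by omega⟩
  have hT : ∀ r : ℝ, Complex.reCLM ((-Complex.I) ^ (p + 2) * r) = 0 := by
    intro r
    rw [show p + 2 = 2 * j + 1 by omega, pow_succ, neg_I_pow_two_mul, mul_assoc,
      Complex.reCLM_apply, Complex.re_ofReal_mul]
    simp
  have hτ : Complex.reCLM ((-Complex.I) ^ (p + 1)) = (-1) ^ j := by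
    rw [hj, neg_I_pow_two_mul]
    exact Complex.ofReal_re _
  have hpt : ∀ x ξ : E (p + 3), ∀ t : ℝ, evenIntegrand f x ξ t =
      (t * Complex.reCLM (Complex.log ((t ^ 2 - ‖x - ξ‖ ^ 2 : ℝ) : ℂ))) •
        filteredMean (p + 1) f ξ t := by
    intro x ξ t
    rw [Complex.reCLM_apply, Complex.log_re, Complex.norm_real, Real.norm_eq_abs]
    rfl
  have hmain := fun x hx =>
    integral_log_filteredMean Complex.reCLM hT hf hfc hR hρR hs (x := x) hx
  simp_rw [← hpt] at hmain
  have hΔ := laplacian_of_eq_smul_newtonPotential hf hfc hR 1 ((-1) ^ j)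
    (I := evenIntegral R f) (fun x hx => by
      rw [← hτ, ← (hmain x hx).2, one_smul]
      rfl)
  refine ⟨fun x hx => ⟨fun ξ hξ => intervalIntegrable_evenIntegrand hf hR.le hρR hs x hξ,
    (hmain x hx).1⟩, hΔ.1, fun x hx => ?_⟩
  rw [hΔ.2 x hx, smul_smul]
  have hpi : Real.pi ^ (-((p + 3 : ℝ) / 2)) * Real.pi ^ ((p + 3 : ℝ) / 2) = 1 := by
    rw [← Real.rpow_add Real.pi_pos]
    simp
  have hsign : ((-1 : ℝ) ^ j) * (-1) ^ j = 1 := by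
    rw [← mul_pow]; simp
  have hG : Real.Gamma ((p + 3 : ℝ) / 2) = (j ! : ℝ) := by
    rw [← Real.Gamma_nat_eq_factorial]
    congr 1
    have : (p : ℝ) + 1 = 2 * j := by exact_mod_cast hj
    linarith
  have hone : dEven (p + 3) R * (1 * (-1) ^ j * R *
      (2 * Real.pi ^ ((p + 3 : ℝ) / 2) * Real.Gamma ((p + 3 : ℝ) / 2))) = 1 := by
    rw [dEven, show (p + 3) / 2 - 1 = j by omega, hG]
    push_cast
    have hj0 : (j ! : ℝ) ≠ 0 := by positivity
    have h4 : (-1 : ℝ) ^ j * Real.pi ^ (-((p + 3 : ℝ) / 2)) / (2 * R * (j ! : ℝ)) *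
        (1 * (-1) ^ j * R * (2 * Real.pi ^ ((p + 3 : ℝ) / 2) * (j ! : ℝ))) =
        ((-1) ^ j * (-1) ^ j) *
          (Real.pi ^ (-((p + 3 : ℝ) / 2)) * Real.pi ^ ((p + 3 : ℝ) / 2)) := by
      field_simp
    rw [h4, hpi, hsign, one_mul]
  rw [hone, one_smul]

end SphericalMeans

theorem theorem3p4 {𝕜 : Type*} [RCLike 𝕜] (n : ℕ) (hn : 3 ≤ n) (R : ℝ) (hR : 0 < R)
    (f : EuclideanSpace ℝ (Fin n) → 𝕜) (hf : ContDiff ℝ ∞ f) (hfc : HasCompactSupport f)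
    (hsupp : tsupport f ⊆ ball 0 R) :
    -- the spherical means are smooth in `t > 0`, so that the powers of `D` act classically
    (∀ ξ ∈ sphere (0 : EuclideanSpace ℝ (Fin n)) R,
      ContDiffOn ℝ ∞ (SphericalMeans.sphericalMean f ξ) (Ioi 0)) ∧
    -- odd dimension
    (Odd n →
      (∀ x ∈ ball (0 : EuclideanSpace ℝ (Fin n)) R,
        Integrable (fun ξ => SphericalMeans.filteredMean (n - 3) f ξ ‖x - ξ‖)
          (SphericalMeans.sphereMeasure n R)) ∧
      ContDiffOn ℝ 2 (SphericalMeans.oddIntegral R f) (ball 0 R) ∧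
      ∀ x ∈ ball (0 : EuclideanSpace ℝ (Fin n)) R,
        f x = SphericalMeans.dOdd n R •
          Laplacian.laplacian (SphericalMeans.oddIntegral R f) x) ∧
    -- even dimension
    (Even n →
      (∀ x ∈ ball (0 : EuclideanSpace ℝ (Fin n)) R,
        (∀ ξ ∈ sphere (0 : EuclideanSpace ℝ (Fin n)) R,
          IntervalIntegrable (SphericalMeans.evenIntegrand f x ξ) volume 0 (2 * R)) ∧
        Integrable (fun ξ => ∫ t in (0 : ℝ)..(2 * R), SphericalMeans.evenIntegrand f x ξ t)
          (SphericalMeans.sphereMeasure n R)) ∧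
      ContDiffOn ℝ 2 (SphericalMeans.evenIntegral R f) (ball 0 R) ∧
      ∀ x ∈ ball (0 : EuclideanSpace ℝ (Fin n)) R,
        f x = SphericalMeans.dEven n R •
          Laplacian.laplacian (SphericalMeans.evenIntegral R f) x) := by
  obtain ⟨p, rfl⟩ : ∃ p, n = p + 3 := ⟨n - 3, by omega⟩
  refine ⟨fun ξ _ => ?_, SphericalMeans.odd_inversion hf hfc hR hsupp,
    SphericalMeans.even_inversion hf hfc hR hsupp⟩
  exact ((SphericalMeans.contDiff_sphericalMean hf).comp
    (contDiff_const.prodMk contDiff_id : ContDiff ℝ ∞ fun t : ℝ => (ξ, t))).contDiffOn
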